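/- Let $E$ be an ordinary elliptic curve over a finite field $\mathbb F_q$, let $\pi$ be its Frobenius endomorphism (raising the coordinates of the points of $E(\overline{\mathbb F}_q)$ to the power $q$), and let $\chi_\pi(x)=x^2-tx+q$, with $t=q+1-\#E(\mathbb F_q)$, be its characteristic polynomial, of discriminant $\Delta=t^2-4q$. Let $\mathcal O$ be an order with $\mathbb Z[\pi]\subseteq\mathcal O\subseteq\operatorname{End}E$ (for instance $\mathcal O=\operatorname{End}E$). Let $\mathfrak a$ be an ideal of $\mathcal O$ of prime norm $\ell=[\mathcal O:\mathfrak a]$ with $\ell\nmid\Delta$, written as $\mathfrak a=\ell\mathcal O+u(\pi)\mathcal O$, where $u\in\mathbb F_\ell[x]$ is a monic irreducible factor of $\chi_\pi\bmod\ell$ (here $u(\pi)$ is formed with any lift of $u$ to $\mathbb Z[x]$). Assume $u\neq x$; this only excludes the case where $\ell$ is the characteristic of $\mathbb F_q$ and $\mathfrak a$ contains $\pi$. Let $\phi_{\mathfrak a}$ be the isogeny with kernel $\bigcap_{\alpha\in\mathfrak a}\ker\alpha\subseteq E(\overline{\mathbb F}_q)$. Then this kernel is a finite-dimensional $\mathbb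 F_\ell$-vector space stable under $\pi$, and the characteristic polynomial of the restriction of $\pi$ to it is $u$. -/

import Mathlib

open Polynomial Filter

open scoped Polynomial.Bivariate WeierstrassCurve.Affine

namespace EllipticFrobenius

section RationalFunctions

variable {K : Type*} [Field K] {W : WeierstrassCurve.Affine K}

/-- The `x`-coordinate of a point of a Weierstrass curve (by convention `0` at the point at
infinity). -/
def xCoord : W.Point → K
  | .zero => 0
  | .some x _ _ => x

/-- The `y`-coordinate of a point of a Weierstrass curve (by convention `0` at the point at
infinity). -/
def yCoord : W.Point → K
  | .zero => 0
  | .some _ y _ => y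

/-- The value of a two-variable polynomial at a point of a Weierstrass curve. -/
noncomputable def polyAt (H : K[X][Y]) (P : W.Point) : K :=
  H.evalEval (xCoord P) (yCoord P)

/-- A function on the points of a Weierstrass curve (over an algebraically closed field) is
rational if at all but finitely many points it is the quotient of two polynomials in the
coordinates, the denominator being nonzero there. -/
def IsRationalFunction (r : W.Point → K) : Prop :=
  ∃ N D : K[X][Y], ∀ᶠ P in cofinite, polyAt D P ≠ 0 ∧ r P = polyAt N P / polyAt D P

lemma eventually_ne_zero : ∀ᶠ P : W.Point in cofinite, P ≠ 0 := by
  simp [Filter.eventually_cofinite]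

lemma equation_coord {P : W.Point} (hP : P ≠ 0) : W.Equation (xCoord P) (yCoord P) := by
  rcases P with _ | ⟨x, y, h⟩
  · exact absurd rfl hP
  · exact h.1

lemma finite_fibre (x : K) : {P : W.Point | P ≠ 0 ∧ xCoord P = x}.Finite := by
  by_cases hne : ∃ P : W.Point, P ≠ 0 ∧ xCoord P = x
  · obtain ⟨P₀, h0, hx0⟩ := hne
    refine (Set.toFinite {P₀, -P₀}).subset ?_
    rintro P ⟨h1, hx1⟩
    rcases P₀ with _ | ⟨x₀, y₀, hh₀⟩
    · exact absurd rfl h0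
    rcases P with _ | ⟨x₁, y₁, hh₁⟩
    · exact absurd rfl h1
    have hx : x₁ = x₀ := by simp only [xCoord] at hx0 hx1; rw [hx0, hx1]
    exact WeierstrassCurve.Affine.Point.X_eq_iff.mp hx
  · convert! Set.finite_empty
    ext P
    simp only [Set.mem_ofPred_eq, Set.mem_empty_iff_false, iff_false]
    exact fun h => hne ⟨P, h⟩

lemma eventually_eval_ne_zero {n : K[X]} (hn : n ≠ 0) :
    ∀ᶠ P : W.Point in cofinite, n.eval (xCoord P) ≠ 0 := by
  rw [Filter.eventually_cofinite]
  have h : (⋃ x ∈ {x | n.IsRoot x}, {P : W.Point | P ≠ 0 ∧ xCoord P = x}).Finite :=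
    (Polynomial.finite_setOfPred_isRoot hn).biUnion fun x _ => finite_fibre x
  refine ((Set.finite_singleton (0 : W.Point)).union h).subset ?_
  intro P hP
  by_cases h0 : P = 0
  · exact Or.inl h0
  · refine Or.inr ?_
    simp only [Set.mem_iUnion]
    exact ⟨xCoord P, by simpa using hP, h0, rfl⟩

lemma polyAt_dichotomy (H : K[X][Y]) :
    (∀ᶠ P : W.Point in cofinite, polyAt H P = 0) ∨
      (∀ᶠ P : W.Point in cofinite, polyAt H P ≠ 0) := by
  have hW : ∀ P : W.Point, P ≠ 0 → polyAt W.polynomial P = 0 := fun P hP => equation_coord hP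
  by_cases hH : WeierstrassCurve.Affine.CoordinateRing.mk W H = 0
  · left
    obtain ⟨G, rfl⟩ := AdjoinRoot.mk_eq_zero.mp hH
    filter_upwards [eventually_ne_zero] with P hP
    have := hW P hP
    simp only [polyAt] at this ⊢
    rw [Polynomial.evalEval_mul, this, zero_mul]
  · right
    have : Module.Finite K[X] W.CoordinateRing :=
      Module.Finite.of_basis (WeierstrassCurve.Affine.CoordinateRing.basis W)
    obtain ⟨n, hn, c, hc⟩ :=
      (Algebra.IsIntegral.isIntegral (R := K[X])
        (WeierstrassCurve.Affine.CoordinateRing.mk W H)).isAlgebraic.exists_nonzero_dvd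
        (mem_nonZeroDivisors_of_ne_zero hH)
    obtain ⟨G, rfl⟩ := AdjoinRoot.mk_surjective c
    have h1 : WeierstrassCurve.Affine.CoordinateRing.mk W (C n) =
        WeierstrassCurve.Affine.CoordinateRing.mk W (H * G) := by
      rw [map_mul]; exact hc
    obtain ⟨E, hE⟩ := AdjoinRoot.mk_eq_mk.mp h1
    filter_upwards [eventually_ne_zero, eventually_eval_ne_zero (W := W) hn] with P hP hnP h0
    apply hnP
    have h2 := congrArg (fun F : K[X][Y] => F.evalEval (xCoord P) (yCoord P)) hE
    have h3 := hW P hP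
    simp only [polyAt] at h3 h0
    simp only [Polynomial.evalEval_sub, Polynomial.evalEval_mul, h3, h0, zero_mul, sub_zero,
      Polynomial.evalEval_C] at h2
    exact h2

namespace IsRationalFunction

variable {r s : W.Point → K}

lemma dichotomy (hr : IsRationalFunction r) :
    (∀ᶠ P in cofinite, r P = 0) ∨ (∀ᶠ P in cofinite, r P ≠ 0) := by
  obtain ⟨N, D, h⟩ := hr
  rcases polyAt_dichotomy (W := W) N with hN | hN
  · left
    filter_upwards [h, hN] with P h1 h2
    rw [h1.2, h2, zero_div]
  · right
    filter_upwards [h, hN] with P h1 h2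
    rw [h1.2]
    exact div_ne_zero h2 h1.1

lemma congr (hr : IsRationalFunction r) (h : ∀ᶠ P in cofinite, r P = s P) :
    IsRationalFunction s := by
  obtain ⟨N, D, h'⟩ := hr
  refine ⟨N, D, ?_⟩
  filter_upwards [h, h'] with P h1 h2
  exact ⟨h2.1, h1 ▸ h2.2⟩

lemma const (c : K) : IsRationalFunction fun _ : W.Point => c :=
  ⟨C (C c), 1, by simp [polyAt, Polynomial.evalEval_C]⟩

lemma add (hr : IsRationalFunction r) (hs : IsRationalFunction s) :
    IsRationalFunction fun P => r P + s P := by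
  obtain ⟨N, D, h⟩ := hr
  obtain ⟨M, E, h'⟩ := hs
  refine ⟨N * E + M * D, D * E, ?_⟩
  filter_upwards [h, h'] with P h1 h2
  obtain ⟨h1, h1'⟩ := h1
  obtain ⟨h2, h2'⟩ := h2
  simp only [polyAt, Polynomial.evalEval_add, Polynomial.evalEval_mul] at *
  refine ⟨mul_ne_zero h1 h2, ?_⟩
  rw [h1', h2']
  field_simp

lemma mul (hr : IsRationalFunction r) (hs : IsRationalFunction s) :
    IsRationalFunction fun P => r P * s P := by
  obtain ⟨N, D, h⟩ := hr
  obtain ⟨M, E, h'⟩ := hs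
  refine ⟨N * M, D * E, ?_⟩
  filter_upwards [h, h'] with P h1 h2
  obtain ⟨h1, h1'⟩ := h1
  obtain ⟨h2, h2'⟩ := h2
  simp only [polyAt, Polynomial.evalEval_mul] at *
  refine ⟨mul_ne_zero h1 h2, ?_⟩
  rw [h1', h2']
  field_simp

lemma neg (hr : IsRationalFunction r) : IsRationalFunction fun P => - r P := by
  simpa using (const (-1)).mul hr

lemma sub (hr : IsRationalFunction r) (hs : IsRationalFunction s) :
    IsRationalFunction fun P => r P - s P := by
  simpa [sub_eq_add_neg] using hr.add hs.neg

lemma inv (hr : IsRationalFunction r) : IsRationalFunction fun P => (r P)⁻¹ := by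
  rcases hr.dichotomy with h0 | h0
  · refine (const 0).congr ?_
    filter_upwards [h0] with P h1
    rw [h1, inv_zero]
  · obtain ⟨N, D, h⟩ := hr
    refine ⟨D, N, ?_⟩
    filter_upwards [h, h0] with P h1 h2
    refine ⟨fun h3 => h2 (by rw [h1.2, h3, zero_div]), by rw [h1.2, inv_div]⟩

lemma div (hr : IsRationalFunction r) (hs : IsRationalFunction s) :
    IsRationalFunction fun P => r P / s P := by
  simpa [div_eq_mul_inv] using hr.mul hs.inv

lemma evalEval (hr : IsRationalFunction r) (hs : IsRationalFunction s) (H : K[X][Y]) :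
    IsRationalFunction fun P => H.evalEval (r P) (s P) := by
  induction H using Polynomial.induction_on' with
  | add p q hp hq => simpa only [Polynomial.evalEval_add] using hp.add hq
  | monomial n a =>
    have hpow : ∀ {t : W.Point → K}, IsRationalFunction t → ∀ m : ℕ,
        IsRationalFunction fun P => t P ^ m := by
      intro t ht m
      induction m with
      | zero => simpa using const 1
      | succ m ih => simpa only [pow_succ] using ih.mul ht
    have ha : IsRationalFunction fun P => a.eval (r P) := by
      induction a using Polynomial.induction_on' with
      | add p q hp hq => simpa only [Polynomial.eval_add] using hp.add hq
      | monomial m c => simpa only [Polynomial.eval_monomial] using (const c).mul (hpow hr m)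
    have := ha.mul (hpow hs n)
    refine this.congr (Eventually.of_forall fun P => ?_)
    simp [Polynomial.evalEval, Polynomial.eval_monomial]

end IsRationalFunction

/-- The coordinate functions are rational. -/
lemma isRationalFunction_xCoord : IsRationalFunction (xCoord (W := W)) :=
  ⟨C X, 1, by simp [polyAt, Polynomial.evalEval_C]⟩

lemma isRationalFunction_yCoord : IsRationalFunction (yCoord (W := W)) :=
  ⟨X, 1, by simp [polyAt, Polynomial.evalEval]⟩

lemma infinite_point [IsAlgClosed K] [W.IsElliptic] : Infinite W.Point := by
  refine Infinite.of_surjective (β := K) xCoord fun x => ?_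
  have hdeg : (W.polynomial.map (Polynomial.evalRingHom x)).degree ≠ 0 := by
    rw [W.monic_polynomial.degree_map, W.degree_polynomial]
    norm_num
  obtain ⟨y, hy⟩ := IsAlgClosed.exists_root _ hdeg
  have h : W.Equation x y := by
    rw [WeierstrassCurve.Affine.Equation, ← Polynomial.map_evalRingHom_eval]
    exact hy
  exact ⟨.some x y (WeierstrassCurve.Affine.equation_iff_nonsingular.mp h), rfl⟩

end RationalFunctions

section Endomorphisms

variable {K : Type*} [Field K] [DecidableEq K] {W : WeierstrassCurve.Affine K}

/-- The algebraic endomorphisms of an elliptic curve over an algebraically closed field: the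
homomorphisms of its group of points that are zero or are given by rational functions of the
coordinates, `P ↦ (r P, s P)`, at all but finitely many points.  (A rational map from a smooth
curve extends to a morphism, and two homomorphisms that agree at all but finitely many points are
equal, so these are exactly the morphisms of curves that are group homomorphisms.) -/
def IsEndomorphism (α : AddMonoid.End W.Point) : Prop :=
  α = 0 ∨ ∃ r s : W.Point → K, IsRationalFunction r ∧ IsRationalFunction s ∧
    ∀ᶠ P in cofinite, ∃ h : W.Nonsingular (r P) (s P), α P = .some (r P) (s P) h

lemma eq_zero_of_eventually_eq [IsAlgClosed K] [W.IsElliptic] {α : AddMonoid.End W.Point}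
    {Q : W.Point} (h : ∀ᶠ P in cofinite, α P = Q) : α = 0 := by
  have : Infinite W.Point := infinite_point
  ext1 R
  have h' : ∀ᶠ P in cofinite, α (P + R) = Q :=
    (add_left_injective R).tendsto_cofinite.eventually h
  obtain ⟨P, h1, h2⟩ := (h.and h').exists
  rw [map_add, h1] at h2
  simpa using h2

namespace IsEndomorphism

lemma eventually_ne [IsAlgClosed K] [W.IsElliptic] {α : AddMonoid.End W.Point}
    (hα : IsEndomorphism α) (h0 : α ≠ 0) (Q : W.Point) : ∀ᶠ P in cofinite, α P ≠ Q := by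
  obtain rfl | ⟨r, s, hr, hs, h⟩ := hα
  · exact absurd rfl h0
  rcases Q with _ | ⟨x, y, hQ⟩
  · filter_upwards [h] with P hP
    obtain ⟨hP, h1⟩ := hP
    rw [h1]
    exact WeierstrassCurve.Affine.Point.some_ne_zero hP
  · rcases (hr.sub (.const x)).dichotomy with hx | hx
    · rcases (hs.sub (.const y)).dichotomy with hy | hy
      · refine absurd (eq_zero_of_eventually_eq (Q := .some x y hQ) ?_) h0
        filter_upwards [h, hx, hy] with P hP hxP hyP
        obtain ⟨hP, h1⟩ := hP
        rw [h1]
        rw [sub_eq_zero] at hxP hyP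
        simp only [hxP, hyP]
      · filter_upwards [h, hy] with P hP hyP h2
        obtain ⟨hP, h1⟩ := hP
        rw [h1, WeierstrassCurve.Affine.Point.some.injEq] at h2
        exact hyP (sub_eq_zero.mpr h2.2)
    · filter_upwards [h, hx] with P hP hxP h2
      obtain ⟨hP, h1⟩ := hP
      rw [h1, WeierstrassCurve.Affine.Point.some.injEq] at h2
      exact hxP (sub_eq_zero.mpr h2.1)

lemma one : IsEndomorphism (1 : AddMonoid.End W.Point) := by
  refine Or.inr ⟨xCoord, yCoord, isRationalFunction_xCoord, isRationalFunction_yCoord, ?_⟩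
  filter_upwards [eventually_ne_zero] with P hP
  rcases P with _ | ⟨x, y, h⟩
  · exact absurd rfl hP
  · exact ⟨h, rfl⟩

lemma neg {α : AddMonoid.End W.Point} (hα : IsEndomorphism α) : IsEndomorphism (-α) := by
  obtain rfl | ⟨r, s, hr, hs, h⟩ := hα
  · exact Or.inl neg_zero
  refine Or.inr ⟨r, fun P => W.negY (r P) (s P), hr,
    (hs.neg.sub ((IsRationalFunction.const W.a₁).mul hr)).sub (.const W.a₃), ?_⟩
  filter_upwards [h] with P hP
  obtain ⟨hP, h1⟩ := hP
  refine ⟨(WeierstrassCurve.Affine.nonsingular_neg ..).mpr hP, ?_⟩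
  change -(α P) = _
  rw [h1, WeierstrassCurve.Affine.Point.neg_some]

lemma mul [IsAlgClosed K] [W.IsElliptic] {α β : AddMonoid.End W.Point}
    (hα : IsEndomorphism α) (hβ : IsEndomorphism β) : IsEndomorphism (α * β) := by
  by_cases hβ0 : β = 0
  · exact Or.inl (by rw [hβ0, mul_zero])
  have hfib := hβ.eventually_ne hβ0
  have hlift : ∀ p : W.Point → Prop, (∀ᶠ P in cofinite, p P) → ∀ᶠ P in cofinite, p (β P) := by
    intro p hp
    refine Filter.Tendsto.eventually (Filter.Tendsto.cofinite_of_finite_preimage_singleton ?_) hp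
    intro Q
    have := hfib Q
    rw [Filter.eventually_cofinite] at this
    simpa [Set.preimage] using this.to_subtype
  obtain rfl | ⟨r, s, ⟨N, D, hr⟩, ⟨M, E, hs⟩, h⟩ := hα
  · exact Or.inl (zero_mul _)
  obtain rfl | ⟨u, v, hu, hv, h'⟩ := hβ
  · exact absurd rfl hβ0
  have key : ∀ (t : W.Point → K) (N D : K[X][Y]),
      (∀ᶠ P in cofinite, polyAt D P ≠ 0 ∧ t P = polyAt N P / polyAt D P) →
      IsRationalFunction fun P => t (β P) := by
    intro t N D ht
    refine ((hu.evalEval hv N).div (hu.evalEval hv D)).congr ?_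
    filter_upwards [hlift _ ht, h'] with P h1 h2
    obtain ⟨h2, h3⟩ := h2
    rw [h1.2, h3]
    rfl
  refine Or.inr ⟨fun P => r (β P), fun P => s (β P), key r N D hr, key s M E hs, ?_⟩
  exact hlift _ h

lemma add [IsAlgClosed K] [W.IsElliptic] {α β : AddMonoid.End W.Point}
    (hα : IsEndomorphism α) (hβ : IsEndomorphism β) : IsEndomorphism (α + β) := by
  have hα' := hα
  have hβ' := hβ
  obtain rfl | ⟨r, s, hr, hs, h⟩ := hα
  · rwa [zero_add]
  obtain rfl | ⟨u, v, hu, hv, h'⟩ := hβ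
  · rwa [add_zero]
  have hnegv : IsRationalFunction fun P => W.negY (u P) (v P) :=
    (hv.neg.sub ((IsRationalFunction.const W.a₁).mul hu)).sub (.const W.a₃)
  have hnegs : IsRationalFunction fun P => W.negY (r P) (s P) :=
    (hs.neg.sub ((IsRationalFunction.const W.a₁).mul hr)).sub (.const W.a₃)
  have main : ∀ l : W.Point → K, IsRationalFunction l →
      (∀ᶠ P in cofinite, ¬ (r P = u P ∧ s P = W.negY (u P) (v P)) ∧
        W.slope (r P) (u P) (s P) (v P) = l P) → IsEndomorphism (α + β) := by
    intro l hl hP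
    have hX : IsRationalFunction fun P => W.addX (r P) (u P) (l P) :=
      ((((hl.mul hl).add ((IsRationalFunction.const W.a₁).mul hl)).sub (.const W.a₂)).sub
        hr).sub hu |>.congr (Eventually.of_forall fun P => by
          simp only [WeierstrassCurve.Affine.addX]; ring)
    have hnY : IsRationalFunction fun P => W.negAddY (r P) (u P) (s P) (l P) :=
      (hl.mul (hX.sub hr)).add hs
    have hY : IsRationalFunction fun P => W.addY (r P) (u P) (s P) (l P) :=
      (hnY.neg.sub ((IsRationalFunction.const W.a₁).mul hX)).sub (.const W.a₃)
    refine Or.inr ⟨_, _, hX, hY, ?_⟩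
    filter_upwards [h, h', hP] with P h1 h2 h3
    obtain ⟨h1, h1'⟩ := h1
    obtain ⟨h2, h2'⟩ := h2
    obtain ⟨h3, h3'⟩ := h3
    rw [← h3']
    refine ⟨WeierstrassCurve.Affine.nonsingular_add h1 h2 h3, ?_⟩
    change α P + β P = _
    rw [h1', h2', WeierstrassCurve.Affine.Point.add_some h3]
  rcases (hr.sub hu).dichotomy with hx | hx
  · rcases (hs.sub hnegv).dichotomy with hy | hy
    · left
      refine eq_zero_of_eventually_eq (Q := 0) ?_
      filter_upwards [h, h', hx, hy] with P h1 h2 h3 h4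
      obtain ⟨h1, h1'⟩ := h1
      obtain ⟨h2, h2'⟩ := h2
      change α P + β P = _
      rw [h1', h2', WeierstrassCurve.Affine.Point.add_of_Y_eq (sub_eq_zero.mp h3)
        (sub_eq_zero.mp h4)]
    · have hnum : IsRationalFunction fun P =>
          3 * r P ^ 2 + 2 * W.a₂ * r P + W.a₄ - W.a₁ * s P :=
        (((((IsRationalFunction.const 3).mul (hr.mul hr)).add
          ((IsRationalFunction.const (2 * W.a₂)).mul hr)).add (.const W.a₄)).sub
          ((IsRationalFunction.const W.a₁).mul hs)).congr
          (Eventually.of_forall fun P => by ring)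
      refine main _ (hnum.div (hs.sub hnegs)) ?_
      filter_upwards [hx, hy] with P h3 h4
      rw [sub_eq_zero] at h3
      rw [sub_ne_zero] at h4
      exact ⟨fun h5 => h4 h5.2, WeierstrassCurve.Affine.slope_of_Y_ne h3 h4⟩
  · refine main _ ((hs.sub hv).div (hr.sub hu)) ?_
    filter_upwards [hx] with P h3
    rw [sub_ne_zero] at h3
    exact ⟨fun h5 => h3 h5.1, WeierstrassCurve.Affine.slope_of_X_ne h3⟩

end IsEndomorphism

/-- The endomorphism ring of an elliptic curve over an algebraically closed field, as a ring of
endomorphisms of its group of points. -/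
def endRing [IsAlgClosed K] (W : WeierstrassCurve.Affine K) [W.IsElliptic] :
    Subring (AddMonoid.End W.Point) where
  carrier := {α | IsEndomorphism α}
  zero_mem' := Or.inl rfl
  one_mem' := IsEndomorphism.one
  add_mem' := IsEndomorphism.add
  mul_mem' := IsEndomorphism.mul
  neg_mem' := IsEndomorphism.neg

end Endomorphisms

section Frobenius

variable {F : Type*} [Field F] [Fintype F] (W : WeierstrassCurve.Affine F)

/-- The integer `t = q + 1 - #W(𝔽_q)`, the trace of the Frobenius endomorphism. -/
noncomputable def frobTrace : ℤ :=
  Fintype.card F + 1 - Nat.card W.Point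

/-- The characteristic polynomial `χ_π = X² - t X + q` of the Frobenius endomorphism. -/
noncomputable def frobPoly : ℤ[X] :=
  X ^ 2 - C (frobTrace W) * X + C (Fintype.card F : ℤ)

variable (K : Type*) [Field K] [Algebra F K] [DecidableEq K]

instance isElliptic_baseChange [W.IsElliptic] : (W⁄K).IsElliptic :=
  inferInstanceAs (WeierstrassCurve.IsElliptic (WeierstrassCurve.map W (algebraMap F K)))

/-- The Frobenius endomorphism `π`, raising the coordinates of a point to the power `q = #F`. -/
noncomputable def frob : AddMonoid.End (W⁄K).Point :=
  WeierstrassCurve.Affine.Point.map (W' := W) (FiniteField.frobeniusAlgHom F K)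

/-- The curve is ordinary: it has a point of order `p` over the algebraically closed field `K`, where
`p` is the characteristic. -/
def IsOrdinary : Prop :=
  ∃ P : (W⁄K).Point, P ≠ 0 ∧ ringChar F • P = 0

end Frobenius

/-- The kernel of the isogeny `φ_𝔞`: the intersection of the kernels of all elements of an ideal `𝔞`
of a ring `O` of endomorphisms.  (`Ideal` means left ideal; endomorphism rings of ordinary elliptic
curves are commutative, so there this is no restriction.) -/
def idealKernel {M : Type*} [AddCommGroup M] {O : Subring (AddMonoid.End M)} (a : Ideal O) :
    AddSubgroup M where
  carrier := {P | ∀ α ∈ a, (α : AddMonoid.End M) P = 0}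
  zero_mem' _ _ := map_zero _
  add_mem' hP hQ α hα := by rw [map_add, hP α hα, hQ α hα, add_zero]
  neg_mem' hP α hα := by rw [map_neg, hP α hα, neg_zero]

lemma mem_idealKernel {M : Type*} [AddCommGroup M] {O : Subring (AddMonoid.End M)} {a : Ideal O}
    {P : M} : P ∈ idealKernel a ↔ ∀ α ∈ a, (α : AddMonoid.End M) P = 0 :=
  Iff.rfl

/-- The characteristic polynomial of the `𝔽_ℓ`-linear endomorphism that `f` induces on a finite
subgroup `N`, which is an `𝔽_ℓ`-vector space and stable under `f`. -/
noncomputable def inducedCharpoly {M : Type*} [AddCommGroup M] (f : AddMonoid.End M)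
    (N : AddSubgroup M) (l : ℕ) [Fact l.Prime] [Module (ZMod l) N] [Finite N]
    (hstab : ∀ P ∈ N, f P ∈ N) : (ZMod l)[X] :=
  (AddMonoidHom.toZModLinearMap l
    ((AddMonoidHom.comp f N.subtype).codRestrict N fun P => hstab P P.2)).charpoly

/-- The subgroup `N` is finite, killed by `ℓ` (hence an `𝔽_ℓ`-vector space) and stable under `f`,
and the restriction of `f` to `N` has characteristic polynomial `u`. -/
def HasCharpolyOn {M : Type*} [AddCommGroup M] (f : AddMonoid.End M) (N : AddSubgroup M) (l : ℕ)
    [Fact l.Prime] (u : (ZMod l)[X]) : Prop :=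
  ∃ (_ : Finite N) (htors : ∀ P : N, l • P = 0) (hstab : ∀ P ∈ N, f P ∈ N),
    letI : Module (ZMod l) N := AddCommGroup.zmodModule htors
    inducedCharpoly f N l hstab = u

end EllipticFrobenius

/-! The quotient of the order by `𝔞` has prime order `ℓ`, so it is generated by 1 and `π ≡ c` modulo
`𝔞` for some integer `c`. Then `ℓ ∣ U(c)`, and the irreducible `u` must be `X - c`, with `c ≠ 0` in
`𝔽_ℓ` because `u ≠ X`. For any natural number `m` congruent to `c`, the kernel of `𝔞` is therefore
`N = E[ℓ] ∩ ker(π - m)`. Since `π` acts on `N` as the scalar `m`, everything reduces to `#N = ℓ`.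

The order of `N` comes from the count `#ker(π - m) = χ_π(m)` for `m` prime to the characteristic
(`card_ker_frob_sub_natCast`). As `ℓ ∣ χ_π(m)`, Cauchy's theorem gives `N ≠ 0`. As `ℓ ∤ Δ`, the root
`c` is simple, so one of two suitable lifts `m`, `m + ℓk` has `ℓ² ∤ χ_π`
(`not_sq_dvd_or_not_sq_dvd`). Since `N` is an `𝔽_ℓ`-space inside the kernel for either lift, its
order is `ℓ`.

The count is obtained from `x`-coordinates alone. An endomorphism induces a rational function `A /
B` on the projective line. The map sending the symmetric functions of `x(P), x(Q)` to those of
`x(P+Q), x(P-Q)` is given by quadratic forms without common zeros. This yields the parallelogram law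
for degrees (`IsAddSub.ratDegree_add`), so `deg(π - m)` is a monic quadratic polynomial in `m`; its
values at 0 and 1 are `q` and `#E(𝔽_q)`. The same forms, expanded at infinity, give `π - m` the
slope `m²` (`IsAddSub.hasSlope`). If this is nonzero, `A / B` is separable, and a generic fibre
shows that the kernel has as many elements as the degree (`IsXMap.card_ker`). -/

namespace EllipticFrobenius

/-! ### The quadratic forms of addition and subtraction on `x`-coordinates -/

section AddSub

variable {R : Type*} [CommRing R]

/-- The first coordinate of the map `(x(P)x(Q) : x(P)+x(Q) : 1) ↦ (x(P+Q)x(P-Q) : x(P+Q)+x(P-Q) : 1)`. -/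
def addSubS (W : WeierstrassCurve R) (s t u : R) : R :=
  s * s - W.b₄ * (s * u) - W.b₆ * (t * u) - W.b₈ * (u * u)

/-- The second coordinate of the addition-and-subtraction map. -/
def addSubT (W : WeierstrassCurve R) (s t u : R) : R :=
  2 * (t * s) + W.b₂ * (s * u) + W.b₄ * (t * u) + W.b₆ * (u * u)

/-- The third coordinate of the addition-and-subtraction map. -/
def addSubU (s t u : R) : R :=
  t * t - 4 * (s * u)

/-- The nonvanishing discriminant makes the three forms a morphism of the projective plane. Both the
degree formula and the absence of cancellation depend on this. -/
lemma addSub_eq_zero [IsReduced R] (W : WeierstrassCurve R) [W.IsElliptic] {s t u : R}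
    (hS : addSubS W s t u = 0) (hT : addSubT W s t u = 0) (hU : addSubU s t u = 0) :
    s = 0 ∧ t = 0 ∧ u = 0 := by
  by_contra h
  have hx : ![s, t, u] ≠ 0 := by
    intro h0
    exact h ⟨congrFun h0 0, congrFun h0 1, congrFun h0 2⟩
  refine WeierstrassCurve.addSubMap_ne_zero W hx ?_
  funext i
  fin_cases i
  · simp only [addSubS] at hS
    simp [WeierstrassCurve.addSubMap]
    linear_combination hS
  · simp only [addSubT] at hT
    simp [WeierstrassCurve.addSubMap]
    linear_combination hT
  · simp only [addSubU] at hU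
    simp [WeierstrassCurve.addSubMap]
    linear_combination hU

end AddSub

/-! ### The addition-and-subtraction identity on points -/

section Points

variable {K : Type*} [Field K] [DecidableEq K] {W : WeierstrassCurve.Affine K}

open WeierstrassCurve.Affine WeierstrassCurve.Affine.Point

/-- The addition-and-subtraction map computes `(x(P+Q)x(P-Q) : x(P+Q)+x(P-Q) : 1)` from
`(x(P)x(Q) : x(P)+x(Q) : 1)`. -/
lemma sym2x_add_sub (P Q : W.Point) : ∃ c : K,
    addSubS W (sym2x P Q 0) (sym2x P Q 1) (sym2x P Q 2) = c * sym2x (P + Q) (P - Q) 0 ∧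
    addSubT W (sym2x P Q 0) (sym2x P Q 1) (sym2x P Q 2) = c * sym2x (P + Q) (P - Q) 1 ∧
    addSubU (sym2x P Q 0) (sym2x P Q 1) (sym2x P Q 2) = c * sym2x (P + Q) (P - Q) 2 := by
  have double : ∀ P : W.Point, ∃ c : K,
      addSubS W (sym2x P P 0) (sym2x P P 1) (sym2x P P 2) = c * sym2x (P + P) 0 0 ∧
      addSubT W (sym2x P P 0) (sym2x P P 1) (sym2x P P 2) = c * sym2x (P + P) 0 1 ∧
      addSubU (sym2x P P 0) (sym2x P P 1) (sym2x P P 2) = c * sym2x (P + P) 0 2 := by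
    rintro (_ | ⟨x, y, h⟩)
    · refine ⟨1, ?_⟩
      rw [← zero_def, add_zero]
      simp [addSubS, addSubT, addSubU]
    · have he := (equation_iff ..).mp h.1
      by_cases hy : y = W.negY x y
      -- Here `2P = 0`, whose symmetric coordinates are `(1, 0, 0)`, so the scalar can only be the
      -- first form.
      · refine ⟨addSubS W (x * x) (x + x) 1, ?_⟩
        rw [add_self_of_Y_eq hy]
        simp only [negY] at hy
        simp [addSubS, addSubT, addSubU, WeierstrassCurve.b₂, WeierstrassCurve.b₄,
          WeierstrassCurve.b₆]
        constructor
        · linear_combination -4 * he + (2 * y + W.a₁ * x + W.a₃) * hy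
        · ring
      · refine ⟨(y - W.negY x y) ^ 2, ?_⟩
        have hy' : y - W.negY x y ≠ 0 := sub_ne_zero.mpr hy
        rw [add_self_of_Y_ne hy]
        simp only [slope_of_Y_ne rfl hy, sym2x_some_some, sym2x_some_zero, addX]
        simp [addSubS, addSubT, addSubU]
        refine ⟨?_, ?_, by ring⟩
        · have h6 : W.a₆ = y ^ 2 + W.a₁ * x * y + W.a₃ * y - (x ^ 3 + W.a₂ * x ^ 2 + W.a₄ * x) := by
            linear_combination -he
          obtain ⟨D, hD⟩ : ∃ D, D = y - (-y - W.a₁ * x - W.a₃) := ⟨_, rfl⟩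
          rw [WeierstrassCurve.Affine.negY] at hy'
          rw [← hD] at hy' ⊢
          field_simp
          rw [hD]
          simp only [WeierstrassCurve.b₄, WeierstrassCurve.b₆, WeierstrassCurve.b₈, h6]
          ring
        · simp only [WeierstrassCurve.b₂, WeierstrassCurve.b₄, WeierstrassCurve.b₆]
          linear_combination -4 * he
  by_cases hPQ : P = Q
  · subst hPQ
    simpa using double P
  by_cases hPQ' : P = -Q
  · subst hPQ'
    obtain ⟨c, hc⟩ := double Q
    refine ⟨c, ?_⟩
    have h1 : -Q + Q = 0 := by simp
    have h2 : -Q - Q = -(Q + Q) := by abel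
    rw [h1, h2, sym2x_neg_left, sym2x_neg_right, sym2x_comm 0]
    exact hc
  rcases P with _ | ⟨x₁, y₁, h₁⟩
  · refine ⟨1, ?_⟩
    rw [← zero_def, zero_add, zero_sub, sym2x_neg_right]
    rcases Q with _ | ⟨x₂, y₂, h₂⟩
    · exact absurd rfl hPQ
    · simp [addSubS, addSubT, addSubU]
      ring
  rcases Q with _ | ⟨x₂, y₂, h₂⟩
  · refine ⟨1, ?_⟩
    rw [← zero_def, add_zero, sub_zero]
    simp [addSubS, addSubT, addSubU]
    ring
  have hx : x₁ ≠ x₂ := by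
    intro hx
    rcases X_eq_iff (h₁ := h₁) (h₂ := h₂) |>.mp hx with h | h
    exacts [hPQ h, hPQ' h]
  have hx' : x₁ - x₂ ≠ 0 := sub_ne_zero.mpr hx
  have e₁ := (equation_iff ..).mp h₁.1
  have e₂ := (equation_iff ..).mp h₂.1
  -- The two curve equations are solved for `a₆` and `a₄`, which turns the claims into identities of
  -- rational functions in the remaining variables.
  have h6 : W.a₆ = y₁ ^ 2 + W.a₁ * x₁ * y₁ + W.a₃ * y₁ - (x₁ ^ 3 + W.a₂ * x₁ ^ 2 + W.a₄ * x₁) := by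
    linear_combination -e₁
  have h4 : W.a₄ = (y₁ ^ 2 + W.a₁ * x₁ * y₁ + W.a₃ * y₁ - (x₁ ^ 3 + W.a₂ * x₁ ^ 2) -
      (y₂ ^ 2 + W.a₁ * x₂ * y₂ + W.a₃ * y₂ - (x₂ ^ 3 + W.a₂ * x₂ ^ 2))) / (x₁ - x₂) := by
    rw [eq_div_iff hx']
    linear_combination e₂ - e₁
  refine ⟨(x₁ - x₂) ^ 2, ?_⟩
  rw [sub_eq_add_neg (Point.some x₁ y₁ h₁), neg_some, add_of_X_ne hx, add_of_X_ne hx]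
  simp only [slope_of_X_ne hx, sym2x_some_some, addX, negY]
  simp [addSubS, addSubT, addSubU]
  refine ⟨?_, ?_, by ring⟩
  · simp only [WeierstrassCurve.b₄, WeierstrassCurve.b₆, WeierstrassCurve.b₈]
    rw [h6, h4]
    field_simp
    ring
  · simp only [WeierstrassCurve.b₂, WeierstrassCurve.b₄, WeierstrassCurve.b₆]
    rw [h6, h4]
    field_simp
    ring

end Points

/-! ### Degree and slope at infinity of rational functions -/

section Polynomials

variable {K : Type*} [Field K]

/-- Two families of polynomials without common zeros that are pointwise proportional differ by a
nonzero constant. -/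
lemma exists_const_mul_of_cross_mul_eq [IsAlgClosed K] {ι : Type*} [Finite ι] {v w : ι → K[X]}
    (hv : ∀ x : K, ∃ i, (v i).eval x ≠ 0) (hw : ∀ x : K, ∃ i, (w i).eval x ≠ 0)
    (h : ∀ i j, v i * w j = v j * w i) : ∃ g : K, g ≠ 0 ∧ ∀ i, w i = C g * v i := by
  have : Fintype ι := Fintype.ofFinite ι
  obtain ⟨d, hd⟩ := IsPrincipalIdealRing.principal (Ideal.span (Set.range v))
  have hdv : ∀ i, d ∣ v i := fun i => by
    rw [← Ideal.mem_span_singleton, Ideal.span, ← hd]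
    exact Ideal.subset_span ⟨i, rfl⟩
  have hd0 : d.degree = 0 := by
    by_contra hdeg
    obtain ⟨x, hx⟩ := IsAlgClosed.exists_root d hdeg
    obtain ⟨i, hi⟩ := hv x
    exact hi (eval_eq_zero_of_dvd_of_eval_eq_zero (hdv i) hx)
  have hdu : IsUnit d := Polynomial.isUnit_iff_degree_eq_zero.mpr hd0
  -- Having no common zero, the `v i` generate the unit ideal. From `1 = ∑ c i * v i` the factor of
  -- proportionality is the polynomial `∑ c i * w i`, which has no root since the `w i` have no
  -- common zero.
  have h1 : (1 : K[X]) ∈ Ideal.span (Set.range v) := by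
    rw [hd]
    exact (Ideal.eq_top_iff_one _).mp (Ideal.span_singleton_eq_top.mpr hdu)
  obtain ⟨c, hc⟩ := (Ideal.mem_span_range_iff_exists_fun).mp h1
  have hwv : ∀ j, w j = (∑ i, c i * w i) * v j := by
    intro j
    rw [← one_mul (w j), ← hc, Finset.sum_mul, Finset.sum_mul]
    exact Finset.sum_congr rfl fun i _ => by linear_combination c i * h i j
  have hg0 : (∑ i, c i * w i).degree = 0 := by
    by_contra hdeg
    obtain ⟨x, hx⟩ := IsAlgClosed.exists_root _ hdeg
    obtain ⟨i, hi⟩ := hw x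
    rw [hwv i, eval_mul, hx.eq_zero, zero_mul] at hi
    exact hi rfl
  rw [eq_C_of_degree_eq_zero hg0] at hwv hg0
  refine ⟨_, ?_, hwv⟩
  rintro h0
  rw [h0] at hg0
  simp at hg0

lemma eval_ne_zero_of_isCoprime {A B : K[X]} (h : IsCoprime A B) (x : K) :
    A.eval x ≠ 0 ∨ B.eval x ≠ 0 := by
  by_contra! h0
  obtain ⟨a, b, hab⟩ := h
  have := congrArg (Polynomial.eval x) hab
  simp [h0.1, h0.2] at this

/-- The degree of the rational function `A / B` in lowest terms. -/
def ratDegree (A B : K[X]) : ℕ :=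
  max A.natDegree B.natDegree

lemma ratDegree_left (A B : K[X]) : A.natDegree ≤ ratDegree A B := le_max_left _ _

lemma ratDegree_right (A B : K[X]) : B.natDegree ≤ ratDegree A B := le_max_right _ _

/-- Coprimality rules out common zeros on the affine line; this is the same statement at infinity,
where the value of `(A : B)` is read off from the coefficients in degree `ratDegree A B`. -/
lemma coeff_ratDegree_ne_zero {A B : K[X]} (h : IsCoprime A B) :
    A.coeff (ratDegree A B) ≠ 0 ∨ B.coeff (ratDegree A B) ≠ 0 := by
  by_contra! h0
  rcases le_total A.natDegree B.natDegree with hle | hle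
  · rw [ratDegree, max_eq_right hle, ← leadingCoeff, leadingCoeff_eq_zero] at h0
    have hA : A = 0 := by
      have := h0.1
      rw [h0.2] at hle
      rw [eq_C_of_natDegree_le_zero hle] at this ⊢
      simpa [h0.2] using this
    exact not_isCoprime_zero_zero (hA ▸ h0.2 ▸ h)
  · rw [ratDegree, max_eq_left hle, ← leadingCoeff, leadingCoeff_eq_zero] at h0
    have hB : B = 0 := by
      have := h0.2
      rw [h0.1] at hle
      rw [eq_C_of_natDegree_le_zero hle] at this ⊢
      simpa [h0.1] using this
    exact not_isCoprime_zero_zero (hB ▸ h0.1 ▸ h)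

variable (W : WeierstrassCurve K)

/-- The pair of rational functions `P / Q, R / S` is, up to order, the image of the pair
`A / B, C / D` under the addition-and-subtraction map. -/
def IsAddSub (A B C' D P Q R S : K[X]) : Prop :=
  ∃ g : K, g ≠ 0 ∧
    addSubS (W.map C) (A * C') (A * D + B * C') (B * D) = C g * (P * R) ∧
    addSubT (W.map C) (A * C') (A * D + B * C') (B * D) = C g * (P * S + Q * R) ∧
    addSubU (A * C') (A * D + B * C') (B * D) = C g * (Q * S)

variable {W}

lemma natDegree_sym2_le {A B : K[X]} {m n : ℕ} (hA : A.natDegree ≤ m) (hB : B.natDegree ≤ m)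
    {D E : K[X]} (hD : D.natDegree ≤ n) (hE : E.natDegree ≤ n) :
    (A * D).natDegree ≤ m + n ∧ (A * E + B * D).natDegree ≤ m + n ∧ (B * E).natDegree ≤ m + n :=
  ⟨natDegree_mul_le_of_le hA hD, natDegree_add_le_of_degree_le (natDegree_mul_le_of_le hA hE)
    (natDegree_mul_le_of_le hB hD), natDegree_mul_le_of_le hB hE⟩

/-- The three expressions are the coefficients of a product of two nonzero linear forms. -/
lemma sym2_ne_zero {a b c d : K} (hab : a ≠ 0 ∨ b ≠ 0) (hcd : c ≠ 0 ∨ d ≠ 0)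
    (h1 : a * c = 0) (h2 : a * d + b * c = 0) (h3 : b * d = 0) : False := by
  rcases mul_eq_zero.mp h1 with rfl | rfl <;> rcases mul_eq_zero.mp h3 with rfl | rfl <;> simp_all

lemma addSub_natDegree_le {s t u : K[X]} {n : ℕ} (hs : s.natDegree ≤ n) (ht : t.natDegree ≤ n)
    (hu : u.natDegree ≤ n) :
    (addSubS (W.map C) s t u).natDegree ≤ n + n ∧ (addSubT (W.map C) s t u).natDegree ≤ n + n ∧
      (addSubU s t u).natDegree ≤ n + n := by
  have hC : ∀ (c : K) {p q : K[X]}, p.natDegree ≤ n → q.natDegree ≤ n →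
      (C c * (p * q)).natDegree ≤ n + n := fun c p q hp hq =>
    (natDegree_C_mul_le _ _).trans (natDegree_mul_le_of_le hp hq)
  have h1 : ∀ {p q : K[X]}, p.natDegree ≤ n → q.natDegree ≤ n → (p * q).natDegree ≤ n + n :=
    fun hp hq => natDegree_mul_le_of_le hp hq
  have h2 := hC 2 ht hs
  have h4 := hC 4 hs hu
  simp only [addSubS, addSubT, addSubU, WeierstrassCurve.map_b₂, WeierstrassCurve.map_b₄,
    WeierstrassCurve.map_b₆, WeierstrassCurve.map_b₈]
  refine ⟨?_, ?_, ?_⟩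
  · exact natDegree_sub_le_of_le (natDegree_sub_le_of_le (natDegree_sub_le_of_le (h1 hs hs)
      (hC _ hs hu)) (hC _ ht hu)) (hC _ hu hu) |>.trans (by simp)
  · exact natDegree_add_le_of_degree_le (natDegree_add_le_of_degree_le
      (natDegree_add_le_of_degree_le h2 (hC _ hs hu)) (hC _ ht hu)) (hC _ hu hu)
  · exact natDegree_sub_le_of_le (h1 ht ht) h4 |>.trans (by simp)

lemma addSub_coeff {s t u : K[X]} {n : ℕ} (hs : s.natDegree ≤ n) (ht : t.natDegree ≤ n)
    (hu : u.natDegree ≤ n) :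
    (addSubS (W.map C) s t u).coeff (n + n) = addSubS W (s.coeff n) (t.coeff n) (u.coeff n) ∧
    (addSubT (W.map C) s t u).coeff (n + n) = addSubT W (s.coeff n) (t.coeff n) (u.coeff n) ∧
    (addSubU s t u).coeff (n + n) = addSubU (s.coeff n) (t.coeff n) (u.coeff n) := by
  have h2 : (2 : K[X]) = C 2 := rfl
  have h4 : (4 : K[X]) = C 4 := rfl
  simp only [addSubS, addSubT, addSubU, WeierstrassCurve.map_b₂, WeierstrassCurve.map_b₄,
    WeierstrassCurve.map_b₆, WeierstrassCurve.map_b₈, h2, h4, coeff_sub, coeff_add, coeff_C_mul,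
    coeff_mul_add_eq_of_natDegree_le hs hs, coeff_mul_add_eq_of_natDegree_le hs hu,
    coeff_mul_add_eq_of_natDegree_le ht hu, coeff_mul_add_eq_of_natDegree_le hu hu,
    coeff_mul_add_eq_of_natDegree_le ht hs, coeff_mul_add_eq_of_natDegree_le ht ht, and_self]

/-- The parallelogram law for degrees. -/
lemma IsAddSub.ratDegree_add [W.IsElliptic] {A B A' B' P Q R S : K[X]}
    (h : IsAddSub W A B A' B' P Q R S) (h1 : IsCoprime A B) (h2 : IsCoprime A' B')
    (h3 : IsCoprime P Q) (h4 : IsCoprime R S) :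
    ratDegree P Q + ratDegree R S = 2 * (ratDegree A B + ratDegree A' B') := by
  obtain ⟨g, hg, hS, hT, hU⟩ := h
  obtain ⟨d1, d2, d3⟩ := natDegree_sym2_le (ratDegree_left A B) (ratDegree_right A B)
    (ratDegree_left A' B') (ratDegree_right A' B')
  obtain ⟨e1, e2, e3⟩ := natDegree_sym2_le (ratDegree_left P Q) (ratDegree_right P Q)
    (ratDegree_left R S) (ratDegree_right R S)
  obtain ⟨f1, f2, f3⟩ := addSub_natDegree_le (W := W) d1 d2 d3
  obtain ⟨c1, c2, c3⟩ := addSub_coeff (W := W) d1 d2 d3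
  rw [two_mul]
  -- Coefficients in the expected top degree are values at infinity. If the left side were smaller,
  -- the forms would vanish there on a nonzero triple; if it were larger, the triple of `P / Q, R /
  -- S` would vanish there.
  rcases lt_trichotomy (ratDegree P Q + ratDegree R S)
    (ratDegree A B + ratDegree A' B' + (ratDegree A B + ratDegree A' B')) with hlt | heq | hgt
  · exfalso
    rw [hS, coeff_C_mul, coeff_eq_zero_of_natDegree_lt (e1.trans_lt hlt), mul_zero] at c1
    rw [hT, coeff_C_mul, coeff_eq_zero_of_natDegree_lt (e2.trans_lt hlt), mul_zero] at c2
    rw [hU, coeff_C_mul, coeff_eq_zero_of_natDegree_lt (e3.trans_lt hlt), mul_zero] at c3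
    obtain ⟨z1, z2, z3⟩ := addSub_eq_zero W c1.symm c2.symm c3.symm
    rw [coeff_add, coeff_mul_add_eq_of_natDegree_le (ratDegree_left ..) (ratDegree_right ..),
      coeff_mul_add_eq_of_natDegree_le (ratDegree_right ..) (ratDegree_left ..)] at z2
    rw [coeff_mul_add_eq_of_natDegree_le (ratDegree_left ..) (ratDegree_left ..)] at z1
    rw [coeff_mul_add_eq_of_natDegree_le (ratDegree_right ..) (ratDegree_right ..)] at z3
    exact sym2_ne_zero (coeff_ratDegree_ne_zero h1) (coeff_ratDegree_ne_zero h2) z1 z2 z3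
  · exact heq
  · exfalso
    have key : ∀ p q : K[X], p = C g * q → p.natDegree < ratDegree P Q + ratDegree R S →
        q.coeff (ratDegree P Q + ratDegree R S) = 0 := by
      intro p q hpq hp
      have := coeff_eq_zero_of_natDegree_lt hp
      rw [hpq, coeff_C_mul] at this
      exact (mul_eq_zero.mp this).resolve_left hg
    have z1 := key _ _ hS (f1.trans_lt hgt)
    have z2 := key _ _ hT (f2.trans_lt hgt)
    have z3 := key _ _ hU (f3.trans_lt hgt)
    rw [coeff_add, coeff_mul_add_eq_of_natDegree_le (ratDegree_left ..) (ratDegree_right ..),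
      coeff_mul_add_eq_of_natDegree_le (ratDegree_right ..) (ratDegree_left ..)] at z2
    rw [coeff_mul_add_eq_of_natDegree_le (ratDegree_left ..) (ratDegree_left ..)] at z1
    rw [coeff_mul_add_eq_of_natDegree_le (ratDegree_right ..) (ratDegree_right ..)] at z3
    exact sym2_ne_zero (coeff_ratDegree_ne_zero h3) (coeff_ratDegree_ne_zero h4) z1 z2 z3

/-- The rational function `A / B` in lowest terms has the expansion `B / A = e / X + O(1 / X ^ 2)` at
infinity. -/
def HasSlope (A B : K[X]) (e : K) : Prop :=
  (reflect (ratDegree A B) A).coeff 0 ≠ 0 ∧ (reflect (ratDegree A B) B).coeff 0 = 0 ∧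
    (reflect (ratDegree A B) B).coeff 1 = e * (reflect (ratDegree A B) A).coeff 0

lemma HasSlope.unique {A B : K[X]} {e e' : K} (h : HasSlope A B e) (h' : HasSlope A B e') :
    e = e' :=
  mul_right_cancel₀ h.1 (h.2.2.symm.trans h'.2.2)

/-- Reflection is the passage to the coordinate `1 / X` at infinity, and the forms, being
homogeneous of degree 2, commute with it. -/
lemma reflect_addSub {s t u : K[X]} {n : ℕ} (hs : s.natDegree ≤ n) (ht : t.natDegree ≤ n)
    (hu : u.natDegree ≤ n) :
    reflect (n + n) (addSubS (W.map C) s t u) =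
      addSubS (W.map C) (reflect n s) (reflect n t) (reflect n u) ∧
    reflect (n + n) (addSubT (W.map C) s t u) =
      addSubT (W.map C) (reflect n s) (reflect n t) (reflect n u) ∧
    reflect (n + n) (addSubU s t u) = addSubU (reflect n s) (reflect n t) (reflect n u) := by
  have h2 : (2 : K[X]) = C 2 := rfl
  have h4 : (4 : K[X]) = C 4 := rfl
  simp only [addSubS, addSubT, addSubU, WeierstrassCurve.map_b₂, WeierstrassCurve.map_b₄,
    WeierstrassCurve.map_b₆, WeierstrassCurve.map_b₈, h2, h4, reflect_sub, reflect_add,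
    reflect_C_mul, reflect_mul _ _ hs hs, reflect_mul _ _ hs hu, reflect_mul _ _ ht hu,
    reflect_mul _ _ hu hu, reflect_mul _ _ ht hs, reflect_mul _ _ ht ht, and_self]

/-- This is adding and subtracting the identity. Only the lowest coefficients at infinity matter: if
`a` is the leading one of `A`, then the three forms begin with `a²`, `2(1 + e)a² / X` and `(1 -
e)²a² / X²`. For `e = m²` the two new slopes have the sum and product of `(m - 1)²` and `(m + 1)²`.
-/
lemma IsAddSub.hasSlope [W.IsElliptic] {A B P Q R S : K[X]} {e : K}
    (h : IsAddSub W A B X 1 P Q R S) (h1 : IsCoprime A B) 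
    (h3 : IsCoprime P Q) (h4 : IsCoprime R S) (he : HasSlope A B e) :
    ∃ f f' : K, HasSlope P Q f ∧ HasSlope R S f' ∧ f + f' = 2 * (1 + e) ∧
      f * f' = (1 - e) ^ 2 := by
  have hdeg := h.ratDegree_add h1 isCoprime_one_right h3 h4
  have hX : ratDegree (X : K[X]) 1 = 1 := by simp [ratDegree]
  rw [hX, two_mul] at hdeg
  obtain ⟨g, hg, hS, hT, hU⟩ := h
  obtain ⟨d1, d2, d3⟩ := natDegree_sym2_le (ratDegree_left A B) (ratDegree_right A B)
    (hX ▸ ratDegree_left (X : K[X]) 1) (hX ▸ ratDegree_right (X : K[X]) 1)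
  obtain ⟨r1, r2, r3⟩ := reflect_addSub (W := W) d1 d2 d3
  have hX1 : (X : K[X]).natDegree ≤ 1 := natDegree_X_le
  have h11 : (1 : K[X]).natDegree ≤ 1 := by simp
  have rX : reflect 1 (X : K[X]) = 1 := by simp
  have r1' : reflect 1 (1 : K[X]) = X := by simp
  rw [hS, ← hdeg, reflect_C_mul, reflect_mul _ _ (ratDegree_left ..) (ratDegree_left ..)] at r1
  rw [hT, ← hdeg, reflect_C_mul, reflect_add,
    reflect_mul _ _ (ratDegree_left ..) (ratDegree_right ..),
    reflect_mul _ _ (ratDegree_right ..) (ratDegree_left ..)] at r2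
  rw [hU, ← hdeg, reflect_C_mul, reflect_mul _ _ (ratDegree_right ..) (ratDegree_right ..)] at r3
  rw [reflect_add, reflect_mul _ _ (ratDegree_left ..) hX1,
    reflect_mul _ _ (ratDegree_left ..) h11, reflect_mul _ _ (ratDegree_right ..) hX1,
    reflect_mul _ _ (ratDegree_right ..) h11, rX, r1', mul_one, mul_one] at r1 r2 r3
  obtain ⟨ha, hb, hb1⟩ := he
  unfold HasSlope
  generalize reflect (ratDegree A B) A = A' at *
  generalize reflect (ratDegree A B) B = B' at *
  generalize reflect (ratDegree P Q) P = P' at *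
  generalize reflect (ratDegree P Q) Q = Q' at *
  generalize reflect (ratDegree R S) R = R' at *
  generalize reflect (ratDegree R S) S = S' at *
  have hc2 : ∀ p q : K[X], (p * q).coeff 2 =
      p.coeff 0 * q.coeff 2 + p.coeff 1 * q.coeff 1 + p.coeff 2 * q.coeff 0 := by
    intro p q
    simp [coeff_mul, Finset.Nat.antidiagonal_succ]
    ring
  have h2 : (2 : K[X]) = C 2 := rfl
  have h4 : (4 : K[X]) = C 4 := rfl
  have q10 := congrArg (fun p => coeff p 0) r1
  have q20 := congrArg (fun p => coeff p 0) r2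
  have q21 := congrArg (fun p => coeff p 1) r2
  have q30 := congrArg (fun p => coeff p 0) r3
  have q32 := congrArg (fun p => coeff p 2) r3
  simp only [addSubS, addSubT, addSubU, WeierstrassCurve.map_b₂, WeierstrassCurve.map_b₄,
    WeierstrassCurve.map_b₆, WeierstrassCurve.map_b₈, h2, h4, coeff_add, coeff_sub, mul_coeff_zero,
    mul_coeff_one, hc2, hb, hb1, coeff_X, coeff_C] at q10 q20 q21 q30 q32
  norm_num at q10 q20 q21 q30 q32
  have hPR : P'.coeff 0 * R'.coeff 0 ≠ 0 := by
    intro h0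
    rw [h0, mul_zero] at q10
    exact ha (mul_self_eq_zero.mp q10.symm)
  obtain ⟨hP, hR⟩ := mul_ne_zero_iff.mp hPR
  have q20' := q20.resolve_left hg
  have hQS : Q'.coeff 0 = 0 ∧ S'.coeff 0 = 0 := by
    rcases q30.resolve_left hg with h0 | h0
    · rw [h0, zero_mul, add_zero] at q20'
      exact ⟨h0, (mul_eq_zero.mp q20').resolve_left hP⟩
    · rw [h0, mul_zero, zero_add] at q20'
      exact ⟨(mul_eq_zero.mp q20').resolve_right hR, h0⟩
  rw [hQS.1, hQS.2, mul_zero, zero_mul, add_zero, zero_add] at q21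
  rw [hQS.1, hQS.2, mul_zero, zero_mul, add_zero, zero_add] at q32
  refine ⟨Q'.coeff 1 / P'.coeff 0, S'.coeff 1 / R'.coeff 0, ⟨hP, hQS.1, by field_simp⟩,
    ⟨hR, hQS.2, by field_simp⟩, ?_, ?_⟩
  · field_simp
    apply mul_left_cancel₀ hg
    linear_combination q21 - 2 * (1 + e) * q10
  · field_simp
    apply mul_left_cancel₀ hg
    linear_combination q32 - (1 - e) ^ 2 * q10

/-- A rational function with nonzero slope at infinity is separable. -/
lemma HasSlope.wronskian_ne_zero {A B : K[X]} {e : K} (h : HasSlope A B e) (he : e ≠ 0) :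
    derivative A * B - A * derivative B ≠ 0 := by
  obtain ⟨ha, hb, hb1⟩ := h
  rw [coeff_reflect, revAt_le (Nat.zero_le _), Nat.sub_zero] at ha hb
  rw [coeff_reflect, coeff_reflect, revAt_le (Nat.zero_le _), Nat.sub_zero] at hb1
  have hA := ratDegree_left A B
  have hB := ratDegree_right A B
  generalize ratDegree A B = n at *
  rcases n with _ | n
  · rw [revAt_eq_self_of_lt (by norm_num), coeff_eq_zero_of_natDegree_lt (by omega)] at hb1
    exact absurd hb1.symm (mul_ne_zero he ha)
  rw [revAt_le (by omega), Nat.add_sub_cancel] at hb1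
  have hB' : B.natDegree ≤ n := by
    refine natDegree_le_iff_coeff_eq_zero.mpr fun i hi => ?_
    rcases (Nat.succ_le_of_lt hi).eq_or_lt with rfl | h2
    · exact hb
    · exact coeff_eq_zero_of_natDegree_lt (hB.trans_lt h2)
  have hXd : ∀ (p : K[X]) (m : ℕ), (X * derivative p).coeff m = m * p.coeff m := by
    intro p m
    rcases m with _ | m
    · simp
    · rw [coeff_X_mul, coeff_derivative]
      push_cast
      ring
  have hXn : ∀ {p : K[X]} {m : ℕ}, p.natDegree ≤ m → (X * derivative p).natDegree ≤ m := by
    intro p m hp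
    refine natDegree_le_iff_coeff_eq_zero.mpr fun i hi => ?_
    rw [hXd, coeff_eq_zero_of_natDegree_lt (hp.trans_lt hi), mul_zero]
  intro h0
  -- After multiplication by `X`, differentiation scales the coefficient of degree `i` by `i`. With
  -- `a` the coefficient of `A` in degree `n + 1`, the coefficient in degree `2n + 1` is `(n + 1)ea²
  -- - nea² = ea²`.
  have h1 : X * derivative A * B - A * (X * derivative B) = 0 := by
    linear_combination X * h0
  have h2 := congrArg (fun p => coeff p (n + 1 + n)) h1
  simp only [coeff_sub, coeff_mul_add_eq_of_natDegree_le (hXn hA) hB',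
    coeff_mul_add_eq_of_natDegree_le hA (hXn hB'), hXd, coeff_zero, hb1] at h2
  push_cast at h2
  refine mul_ne_zero he (mul_ne_zero ha ha) ?_
  linear_combination h2

end Polynomials

/-! ### Endomorphisms as rational functions of `x` -/

section XMap

variable {K : Type*} [Field K] {W : WeierstrassCurve.Affine K}

lemma exists_ne_zero_xCoord_eq [IsAlgClosed K] [W.IsElliptic] (x : K) :
    ∃ P : W.Point, P ≠ 0 ∧ xCoord P = x := by
  have hdeg : (W.polynomial.map (Polynomial.evalRingHom x)).degree ≠ 0 := by
    rw [W.monic_polynomial.degree_map, W.degree_polynomial]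
    norm_num
  obtain ⟨y, hy⟩ := IsAlgClosed.exists_root _ hdeg
  have h : W.Equation x y := by
    rw [WeierstrassCurve.Affine.Equation, ← Polynomial.map_evalRingHom_eval]
    exact hy
  exact ⟨.some x y (WeierstrassCurve.Affine.equation_iff_nonsingular.mp h),
    WeierstrassCurve.Affine.Point.some_ne_zero _, rfl⟩

lemma poly_eq_of_eventually [IsAlgClosed K] [W.IsElliptic] {p q : K[X]}
    (h : ∀ᶠ P : W.Point in cofinite, p.eval (xCoord P) = q.eval (xCoord P)) : p = q := by
  by_contra hpq
  have : Infinite W.Point := infinite_point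
  obtain ⟨P, h1, h2⟩ := (h.and (eventually_eval_ne_zero (sub_ne_zero.mpr hpq))).exists
  rw [eval_sub, h1, sub_self] at h2
  exact h2 rfl

lemma exists_polyAt_eq (H : K[X][Y]) :
    ∃ p q : K[X], ∀ P : W.Point, P ≠ 0 →
      polyAt H P = p.eval (xCoord P) + q.eval (xCoord P) * yCoord P := by
  obtain ⟨p, q, hpq⟩ := WeierstrassCurve.Affine.CoordinateRing.exists_smul_basis_eq
    (WeierstrassCurve.Affine.CoordinateRing.mk W H)
  refine ⟨p, q, fun P hP => ?_⟩
  simp only [WeierstrassCurve.Affine.CoordinateRing.smul, mul_one, ← map_mul, ← map_add] at hpq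
  obtain ⟨E, hE⟩ := AdjoinRoot.mk_eq_mk.mp hpq.symm
  have h1 := congrArg (fun F : K[X][Y] => F.evalEval (xCoord P) (yCoord P)) hE
  have h2 : W.polynomial.evalEval (xCoord P) (yCoord P) = 0 := equation_coord hP
  simp only [evalEval_sub, evalEval_add, evalEval_mul, h2, zero_mul, evalEval_C, evalEval_X] at h1
  rw [polyAt]
  linear_combination h1

/-- At a point with `P = -P` the square `(2y + a₁x + a₃)²` vanishes, and on the curve it equals `4x³
+ b₂x² + 2b₄x + b₆`. If this polynomial were zero, also in characteristic 2, then `Δ = 0`. -/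
lemma eventually_ne_neg [W.IsElliptic] : ∀ᶠ P : W.Point in cofinite, P ≠ -P := by
  have hp : C 4 * X ^ 3 + C W.b₂ * X ^ 2 + C (2 * W.b₄) * X + C W.b₆ ≠ (0 : K[X]) := by
    intro h0
    have h3 := congrArg (fun p => coeff p 3) h0
    have h2 := congrArg (fun p => coeff p 2) h0
    have h1 := congrArg (fun p => coeff p 1) h0
    have h0 := congrArg (fun p => coeff p 0) h0
    simp [coeff_X, coeff_C] at h3 h2 h1 h0
    have hΔ : W.Δ = 0 := by
      rw [WeierstrassCurve.Δ, h2, h0]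
      linear_combination (-2 * W.b₄ ^ 3) * h3
    exact (WeierstrassCurve.isUnit_Δ W).ne_zero hΔ
  filter_upwards [eventually_eval_ne_zero hp, eventually_ne_zero] with P hP h0 hneg
  rcases P with _ | ⟨x, y, h⟩
  · exact h0 rfl
  have he := (WeierstrassCurve.Affine.equation_iff ..).mp h.1
  rw [WeierstrassCurve.Affine.Point.neg_some, WeierstrassCurve.Affine.Point.some.injEq] at hneg
  have hy := hneg.2
  rw [WeierstrassCurve.Affine.negY] at hy
  apply hP
  simp only [xCoord, eval_add, eval_mul, eval_C, eval_pow, eval_X, WeierstrassCurve.b₂,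
    WeierstrassCurve.b₄, WeierstrassCurve.b₆]
  linear_combination (2 * y + W.a₁ * x + W.a₃) * hy - 4 * he

lemma xCoord_neg (P : W.Point) : xCoord (-P) = xCoord P := by
  rcases P with _ | ⟨x, y, h⟩ <;> rfl

lemma yCoord_ne_yCoord_neg {P : W.Point} (hP : P ≠ -P) : yCoord P - yCoord (-P) ≠ 0 := by
  rcases P with _ | ⟨x, y, h⟩
  · exact absurd rfl hP
  · intro h0
    apply hP
    rw [WeierstrassCurve.Affine.Point.neg_some, WeierstrassCurve.Affine.Point.some.injEq]
    exact ⟨rfl, sub_eq_zero.mp h0⟩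

/-- An even rational function on a Weierstrass curve is a rational function of `x`. -/
lemma IsRationalFunction.exists_eval_div_eval [DecidableEq K] [IsAlgClosed K] [W.IsElliptic] {r : W.Point → K}
    (hr : IsRationalFunction r) (heven : ∀ P, r (-P) = r P) :
    ∃ A B : K[X], IsCoprime A B ∧ ∀ᶠ P in cofinite,
      B.eval (xCoord P) ≠ 0 ∧ r P = A.eval (xCoord P) / B.eval (xCoord P) := by
  classical
  suffices h : ∃ A B : K[X], B ≠ 0 ∧ ∀ᶠ P in cofinite,
      r P * B.eval (xCoord P) = A.eval (xCoord P) by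
    obtain ⟨A, B, hB, h⟩ := h
    obtain ⟨A', hA'⟩ := EuclideanDomain.gcd_dvd_left A B
    obtain ⟨B', hB'⟩ := EuclideanDomain.gcd_dvd_right A B
    have hg : EuclideanDomain.gcd A B ≠ 0 := fun h0 => hB (by rw [hB', h0, zero_mul])
    have hB'0 : B' ≠ 0 := fun h0 => hB (by rw [hB', h0, mul_zero])
    refine ⟨A', B', ?_, ?_⟩
    · obtain ⟨a, b, hab⟩ : ∃ a b, EuclideanDomain.gcd A B = A * a + B * b :=
        ⟨_, _, EuclideanDomain.gcd_eq_gcd_ab A B⟩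
      refine ⟨a, b, mul_left_cancel₀ hg ?_⟩
      linear_combination -hab - a * hA' - b * hB'
    · filter_upwards [h, eventually_eval_ne_zero hg, eventually_eval_ne_zero hB'0] with P h1 h2 h3
      refine ⟨h3, ?_⟩
      rw [eq_div_iff h3]
      apply mul_left_cancel₀ h2
      have e1 := congrArg (Polynomial.eval (xCoord P)) hA'
      have e2 := congrArg (Polynomial.eval (xCoord P)) hB'
      rw [eval_mul] at e1 e2
      linear_combination h1 + e1 - r P * e2
  obtain ⟨N, D, h⟩ := hr
  obtain ⟨p, q, hpq⟩ := exists_polyAt_eq (W := W) D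
  obtain ⟨p', q', hpq'⟩ := exists_polyAt_eq (W := W) N
  have hneg : ∀ᶠ P in cofinite, polyAt D (-P) ≠ 0 ∧ r (-P) = polyAt N (-P) / polyAt D (-P) :=
    neg_injective.tendsto_cofinite.eventually h
  -- With `r = (p' + q'y) / (p + qy)`, cross-multiplying `r(P) = r(-P)` leaves `(y(P) - y(-P))(q'p -
  -- p'q) = 0`. Hence `r` is `p' / p`, or `q' / q` when `p = 0`; no division by 2 is involved.
  have hpoly : q' * p = p' * q := by
    apply poly_eq_of_eventually (W := W)
    filter_upwards [h, hneg, eventually_ne_zero, eventually_ne_neg] with P h1 h2 h0 hne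
    have h3 : polyAt N P * polyAt D (-P) = polyAt N (-P) * polyAt D P := by
      have := heven P
      rw [h1.2, h2.2, div_eq_div_iff h2.1 h1.1] at this
      exact this.symm
    rw [hpq P h0, hpq' P h0, hpq _ (neg_ne_zero.mpr h0), hpq' _ (neg_ne_zero.mpr h0),
      xCoord_neg] at h3
    rw [eval_mul, eval_mul]
    apply mul_left_cancel₀ (yCoord_ne_yCoord_neg hne)
    linear_combination h3
  have : Infinite W.Point := infinite_point
  have hmain : ∀ᶠ P in cofinite, P ≠ 0 ∧
      p.eval (xCoord P) + q.eval (xCoord P) * yCoord P ≠ 0 ∧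
      r P * (p.eval (xCoord P) + q.eval (xCoord P) * yCoord P) =
        p'.eval (xCoord P) + q'.eval (xCoord P) * yCoord P := by
    filter_upwards [h, eventually_ne_zero] with P h1 h0
    rw [← hpq P h0, ← hpq' P h0]
    exact ⟨h0, h1.1, by rw [h1.2, div_mul_cancel₀ _ h1.1]⟩
  have hev : ∀ x, q'.eval x * p.eval x = p'.eval x * q.eval x := fun x => by
    rw [← eval_mul, ← eval_mul, hpoly]
  by_cases hp : p = 0
  · refine ⟨q', q, ?_, ?_⟩
    · rintro rfl
      obtain ⟨P, h1⟩ := hmain.exists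
      simp [hp] at h1
    · filter_upwards [hmain] with P ⟨_, h1, h2⟩
      apply mul_right_cancel₀ h1
      linear_combination q.eval (xCoord P) * h2 - hev (xCoord P)
  · refine ⟨p', p, hp, ?_⟩
    filter_upwards [hmain] with P ⟨_, h1, h2⟩
    apply mul_right_cancel₀ h1
    linear_combination p.eval (xCoord P) * h2 + yCoord P * hev (xCoord P)

lemma eval_addSub (s t u : K[X]) (x : K) :
    (addSubS (WeierstrassCurve.map W C) s t u).eval x =
      addSubS W (s.eval x) (t.eval x) (u.eval x) ∧
    (addSubT (WeierstrassCurve.map W C) s t u).eval x =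
      addSubT W (s.eval x) (t.eval x) (u.eval x) ∧
    (addSubU s t u).eval x = addSubU (s.eval x) (t.eval x) (u.eval x) := by
  simp [addSubS, addSubT, addSubU]

variable [DecidableEq K]

open WeierstrassCurve.Affine.Point

/-- The homomorphism `α` is given on `x`-coordinates by the rational function `A / B` in lowest
terms. -/
structure IsXMap (α : AddMonoid.End W.Point) (A B : K[X]) : Prop where
  isCoprime : IsCoprime A B
  eventually : ∀ᶠ P in cofinite, ∃ c : K, A.eval (xCoord P) = c * xRep (α P) 0 ∧
    B.eval (xCoord P) = c * xRep (α P) 1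

lemma IsXMap.one : IsXMap (1 : AddMonoid.End W.Point) X 1 where
  isCoprime := isCoprime_one_right
  eventually := by
    filter_upwards [eventually_ne_zero] with P hP
    rcases P with _ | ⟨x, y, h⟩
    · exact absurd rfl hP
    · exact ⟨1, by simp [xCoord]⟩

lemma IsEndomorphism.exists_isXMap [IsAlgClosed K] [W.IsElliptic] {α : AddMonoid.End W.Point}
    (hα : IsEndomorphism α) : ∃ A B : K[X], IsXMap α A B := by
  obtain rfl | ⟨r, s, hr, -, h⟩ := hα
  -- The zero endomorphism is the constant function with value infinity.
  · refine ⟨1, 0, isCoprime_one_left, Eventually.of_forall fun P => ⟨1, ?_⟩⟩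
    rw [show (0 : AddMonoid.End W.Point) P = 0 from rfl]
    simp
  have hr' : IsRationalFunction fun P => xCoord (α P) := by
    refine hr.congr ?_
    filter_upwards [h] with P hP
    obtain ⟨_, h1⟩ := hP
    rw [h1]
    rfl
  obtain ⟨A, B, hAB, h'⟩ := hr'.exists_eval_div_eval fun P => by rw [map_neg, xCoord_neg]
  refine ⟨A, B, hAB, ?_⟩
  filter_upwards [h, h'] with P hP hAB
  obtain ⟨hns, h1⟩ := hP
  refine ⟨B.eval (xCoord P), ?_⟩
  have h2 := (eq_div_iff hAB.1).mp hAB.2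
  rw [h1] at h2 ⊢
  change r P * _ = _ at h2
  simp [← h2, mul_comm]

/-- At almost every point `T` both triples are multiples of the symmetric coordinates of `αT + βT,
αT - βT`, so they are proportional as polynomials. Neither has a common zero, hence the factor is a
constant. -/
lemma IsXMap.isAddSub [IsAlgClosed K] [W.IsElliptic] {α β : AddMonoid.End W.Point}
    {A B A' B' P Q R S : K[X]} (h₁ : IsXMap α A B) (h₂ : IsXMap β A' B')
    (h₃ : IsXMap (α + β) P Q) (h₄ : IsXMap (α - β) R S) : IsAddSub W A B A' B' P Q R S := by
  have key := exists_const_mul_of_cross_mul_eq (v := ![P * R, P * S + Q * R, Q * S])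
    (w := ![addSubS (WeierstrassCurve.map W C) (A * A') (A * B' + B * A') (B * B'),
      addSubT (WeierstrassCurve.map W C) (A * A') (A * B' + B * A') (B * B'),
      addSubU (A * A') (A * B' + B * A') (B * B')]) ?_ ?_ ?_
  · obtain ⟨g, hg, h⟩ := key
    exact ⟨g, hg, h 0, h 1, h 2⟩
  · intro x
    by_contra! h
    have z1 := h 0
    have z2 := h 1
    have z3 := h 2
    simp at z1 z2 z3
    exact sym2_ne_zero (eval_ne_zero_of_isCoprime h₃.isCoprime x)
      (eval_ne_zero_of_isCoprime h₄.isCoprime x) (by simpa using z1) z2 (by simpa using z3)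
  · intro x
    by_contra! h
    have z1 := h 0
    have z2 := h 1
    have z3 := h 2
    obtain ⟨e1, e2, e3⟩ := eval_addSub (W := W) (A * A') (A * B' + B * A') (B * B') x
    obtain ⟨y1, y2, y3⟩ := addSub_eq_zero W (e1.symm.trans z1) (e2.symm.trans z2)
      (e3.symm.trans z3)
    simp only [eval_add, eval_mul] at y1 y2 y3
    exact sym2_ne_zero (eval_ne_zero_of_isCoprime h₁.isCoprime x)
      (eval_ne_zero_of_isCoprime h₂.isCoprime x) y1 y2 y3
  · intro i j
    apply poly_eq_of_eventually (W := W)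
    filter_upwards [h₁.eventually, h₂.eventually, h₃.eventually, h₄.eventually]
      with T ⟨a, a1, a2⟩ ⟨b, b1, b2⟩ ⟨c, c1, c2⟩ ⟨d, d1, d2⟩
    obtain ⟨k, k1, k2, k3⟩ := sym2x_add_sub (α T) (β T)
    obtain ⟨e1, e2, e3⟩ := eval_addSub (W := W) (A * A') (A * B' + B * A') (B * B') (xCoord T)
    have hadd : (α + β) T = α T + β T := rfl
    have hsub : (α - β) T = α T - β T := rfl
    rw [hadd] at c1 c2
    rw [hsub] at d1 d2
    have hv : ∀ i, ((![P * R, P * S + Q * R, Q * S] : Fin 3 → K[X]) i).eval (xCoord T) =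
        c * d * sym2x (α T + β T) (α T - β T) i := by
      intro i
      fin_cases i <;> simp [sym2x, c1, c2, d1, d2] <;> ring
    have hw : ∀ i, ((![addSubS (WeierstrassCurve.map W C) (A * A') (A * B' + B * A') (B * B'),
        addSubT (WeierstrassCurve.map W C) (A * A') (A * B' + B * A') (B * B'),
        addSubU (A * A') (A * B' + B * A') (B * B')] : Fin 3 → K[X]) i).eval (xCoord T) =
        (a * b) ^ 2 * k * sym2x (α T + β T) (α T - β T) i := by
      have s0 : (A * A').eval (xCoord T) = a * b * sym2x (α T) (β T) 0 := by
        simp [sym2x, a1, b1]; ring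
      have s1 : (A * B' + B * A').eval (xCoord T) = a * b * sym2x (α T) (β T) 1 := by
        simp [sym2x, a1, b1, a2, b2]; ring
      have s2 : (B * B').eval (xCoord T) = a * b * sym2x (α T) (β T) 2 := by
        simp [sym2x, a2, b2]; ring
      rw [s0, s1, s2] at e1 e2 e3
      intro i
      fin_cases i
      · refine e1.trans ?_
        change _ = (a * b) ^ 2 * k * sym2x (α T + β T) (α T - β T) 0
        simp only [addSubS] at k1 ⊢
        linear_combination (a * b) ^ 2 * k1
      · refine e2.trans ?_
        change _ = (a * b) ^ 2 * k * sym2x (α T + β T) (α T - β T) 1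
        simp only [addSubT] at k2 ⊢
        linear_combination (a * b) ^ 2 * k2
      · refine e3.trans ?_
        change _ = (a * b) ^ 2 * k * sym2x (α T + β T) (α T - β T) 2
        simp only [addSubU] at k3 ⊢
        linear_combination (a * b) ^ 2 * k3
    rw [eval_mul, eval_mul, hv, hv, hw, hw]
    ring

end XMap

/-! ### The order of the kernel of a separable endomorphism -/

section Kernel

variable {K : Type*} [Field K] [DecidableEq K] {W : WeierstrassCurve.Affine K}

open WeierstrassCurve.Affine.Point

lemma card_roots_toFinset_of_derivative_ne_zero [IsAlgClosed K] {f : K[X]}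
    (h : ∀ x, f.eval x = 0 → (derivative f).eval x ≠ 0) : f.roots.toFinset.card = f.natDegree := by
  have hnodup : f.roots.Nodup := by
    rw [Multiset.nodup_iff_count_le_one]
    intro x
    rw [count_roots]
    by_contra! hlt
    have hf : f ≠ 0 := by
      rintro rfl
      simp at hlt
    obtain ⟨h1, h2⟩ := (one_lt_rootMultiplicity_iff_isRoot hf).mp hlt
    exact h x h1 h2
  rw [Multiset.toFinset_card_of_nodup hnodup]
  exact splits_iff_card_roots.mp (IsAlgClosed.splits f)

/-- The kernel of a separable endomorphism has as many elements as the degree of the endomorphism. -/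
lemma IsXMap.card_ker [IsAlgClosed K] [W.IsElliptic] {α : AddMonoid.End W.Point} {A B : K[X]}
    (h : IsXMap α A B) (hα : IsEndomorphism α)
    (hsep : derivative A * B - A * derivative B ≠ 0) :
    Finite (AddMonoidHom.ker α) ∧ Nat.card (AddMonoidHom.ker α) = ratDegree A B := by
  have hα0 : α ≠ 0 := by
    rintro rfl
    have hB : B = 0 := by
      apply poly_eq_of_eventually (W := W)
      filter_upwards [h.eventually] with P ⟨c, _, hc⟩
      rw [hc, show (0 : AddMonoid.End W.Point) P = 0 from rfl]
      simp
    simp [hB] at hsep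
  have htend : Tendsto α cofinite cofinite := by
    refine Filter.Tendsto.cofinite_of_finite_preimage_singleton fun Q => ?_
    have := hα.eventually_ne hα0 Q
    rw [Filter.eventually_cofinite] at this
    simpa [Set.preimage] using this.to_subtype
  let G : W.Point → Prop := fun P => P ≠ 0 ∧
    (∃ c : K, A.eval (xCoord P) = c * xRep (α P) 0 ∧ B.eval (xCoord P) = c * xRep (α P) 1) ∧
    (derivative A * B - A * derivative B).eval (xCoord P) ≠ 0
  have hG : ∀ᶠ P in cofinite, G P := by
    filter_upwards [eventually_ne_zero, h.eventually, eventually_eval_ne_zero hsep]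
      with P h1 h2 h3
    exact ⟨h1, h2, h3⟩
  have hlin : ∀ a b : K, (a ≠ 0 ∨ b ≠ 0) → ∀ᶠ Q : W.Point in cofinite, a - xCoord Q * b ≠ 0 := by
    intro a b hab
    have hp : C a - X * C b ≠ (0 : K[X]) := by
      intro h0
      have h1 := congrArg (fun p => coeff p 1) h0
      have h0 := congrArg (fun p => coeff p 0) h0
      simp [coeff_C] at h1 h0
      simp_all
    filter_upwards [eventually_eval_ne_zero hp] with Q hQ
    rwa [eval_sub, eval_C, eval_mul, eval_X, eval_C] at hQ
  rw [Filter.eventually_cofinite] at hG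
  -- Conditions on a generic value `Q`: it differs from `-Q`, `A - x(Q)B` keeps its full degree, and
  -- no exceptional point lies over `x(Q)`. Since `α` has finite fibres, some value `α P₀` satisfies
  -- them all.
  have hQ : ∀ᶠ Q : W.Point in cofinite, Q ≠ 0 ∧ Q ≠ -Q ∧
      A.coeff (ratDegree A B) - xCoord Q * B.coeff (ratDegree A B) ≠ 0 ∧
      ∀ T ∈ {P | ¬ G P}, Q ≠ α T ∧ Q ≠ -α T ∧ A.eval (xCoord T) - xCoord Q * B.eval (xCoord T) ≠ 0 := by
    refine eventually_ne_zero.and (eventually_ne_neg.and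
      ((hlin _ _ (coeff_ratDegree_ne_zero h.isCoprime)).and ?_))
    rw [eventually_all_finite hG]
    intro T _
    refine Eventually.and ?_ (Eventually.and ?_
      (hlin _ _ (eval_ne_zero_of_isCoprime h.isCoprime (xCoord T))))
    · simp [Filter.eventually_cofinite]
    · simp [Filter.eventually_cofinite]
  have : Infinite W.Point := infinite_point
  obtain ⟨P₀, hP0, hPneg, hPdeg, hPbad⟩ := (htend.eventually hQ).exists
  obtain ⟨Q, hQ⟩ : ∃ Q, Q = α P₀ := ⟨_, rfl⟩
  rw [← hQ] at hP0 hPneg hPdeg hPbad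
  obtain ⟨f, hf⟩ : ∃ f, f = A - C (xCoord Q) * B := ⟨_, rfl⟩
  have hfe : ∀ x, f.eval x = A.eval x - xCoord Q * B.eval x := by simp [hf]
  have hdeg : f.natDegree = ratDegree A B := by
    refine natDegree_eq_of_le_of_coeff_ne_zero ?_ (by simpa [hf] using hPdeg)
    rw [hf]
    exact natDegree_sub_le_of_le (ratDegree_left A B)
      ((natDegree_C_mul_le _ _).trans (ratDegree_right A B)) |>.trans (by simp)
  have hgood : ∀ P, f.eval (xCoord P) = 0 → G P := by
    intro P hP
    by_contra hbad
    exact (hPbad P hbad).2.2 (by rw [← hfe, hP])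
  have hfib : ∀ P, f.eval (xCoord P) = 0 → α P = Q ∨ α P = -Q := by
    intro P hP
    obtain ⟨-, ⟨c, hA, hB⟩, -⟩ := hgood P hP
    rw [hfe, hA, hB] at hP
    have hc : c ≠ 0 := by
      rintro rfl
      rcases eval_ne_zero_of_isCoprime h.isCoprime (xCoord P) with h1 | h1
      · exact h1 (by rw [hA, zero_mul])
      · exact h1 (by rw [hB, zero_mul])
    rcases hαP : α P with _ | ⟨x, y, hxy⟩
    · rw [hαP, ← zero_def] at hP
      simp [hc] at hP
    · rcases hQP : Q with _ | ⟨x', y', hxy'⟩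
      · exact absurd hQP hP0
      rw [hαP, hQP] at hP
      simp only [xRep_some, Matrix.cons_val_zero, Matrix.cons_val_one, xCoord] at hP
      refine X_eq_iff.mp (mul_left_cancel₀ hc ?_)
      linear_combination hP
  have hroot : ∀ P, α P = Q → f.eval (xCoord P) = 0 := by
    intro P hP
    have hGP : G P := by
      by_contra hbad
      exact (hPbad P hbad).1 hP.symm
    obtain ⟨-, ⟨c, hA, hB⟩, -⟩ := hGP
    rw [hP] at hA hB
    rcases Q with _ | ⟨x', y', hxy'⟩
    · exact absurd rfl hP0
    rw [hfe, hA, hB]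
    simp [xCoord]
    ring
  have hf0 : f ≠ 0 := by
    rintro rfl
    exact hPdeg (by
      have := congrArg (fun p => coeff p (ratDegree A B)) hf
      simpa using this.symm)
  have hcard : f.roots.toFinset.card = f.natDegree := by
    refine card_roots_toFinset_of_derivative_ne_zero fun x hx hx' => ?_
    obtain ⟨P, -, rfl⟩ := exists_ne_zero_xCoord_eq (W := W) x
    obtain ⟨-, -, hw⟩ := hgood P hx
    apply hw
    rw [hfe] at hx
    simp only [hf, derivative_sub, derivative_C_mul, eval_sub, eval_mul, eval_C] at hx' ⊢
    -- A multiple root of `f = A - x(Q)B` would be a zero of the Wronskian, which equals `f'B -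
    -- fB'`.
    linear_combination B.eval (xCoord P) * hx' - (derivative B).eval (xCoord P) * hx
  have hmem : ∀ P : AddMonoidHom.ker α, xCoord (P₀ + P.1) ∈ f.roots.toFinset := by
    intro P
    rw [Multiset.mem_toFinset, mem_roots hf0]
    refine hroot _ ?_
    rw [map_add, show α P.1 = 0 from P.2, add_zero, hQ]
  -- Translation by `P₀` carries the kernel to the fibre over `Q`, and `x` maps this fibre
  -- bijectively to the roots of `f`: a root lies under points over `Q` or `-Q`, and `Q ≠ -Q`
  -- prevents two points of the fibre from being opposite.
  have hbij : Function.Bijective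
      fun P : AddMonoidHom.ker α => (⟨xCoord (P₀ + P.1), hmem P⟩ : f.roots.toFinset) := by
    constructor
    · intro P P' hPP'
      have hx : xCoord (P₀ + P.1) = xCoord (P₀ + P'.1) := congrArg Subtype.val hPP'
      have hαP : ∀ P : AddMonoidHom.ker α, α (P₀ + P.1) = Q := fun P => by
        rw [map_add, show α P.1 = 0 from P.2, add_zero, hQ]
      have hne : ∀ P : AddMonoidHom.ker α, (P₀ + P.1) ≠ 0 := fun P h0 => by
        have := hαP P
        rw [h0, _root_.map_zero] at this
        exact hP0 this.symm
      have hpm : (P₀ + P.1) = P₀ + P'.1 ∨ (P₀ + P.1) = -(P₀ + P'.1) := by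
        have h1 := hne P
        have h2 := hne P'
        generalize (P₀ + P.1) = R at *
        generalize (P₀ + P'.1) = R' at *
        rcases R with _ | ⟨x, y, hxy⟩
        · exact absurd rfl h1
        rcases R' with _ | ⟨x', y', hxy'⟩
        · exact absurd rfl h2
        exact X_eq_iff.mp hx
      rcases hpm with h1 | h1
      · exact Subtype.ext (add_left_cancel h1)
      · have := congrArg α h1
        rw [map_neg, hαP, hαP] at this
        exact absurd this hPneg
    · rintro ⟨x, hx⟩
      rw [Multiset.mem_toFinset, mem_roots hf0] at hx
      obtain ⟨P, -, rfl⟩ := exists_ne_zero_xCoord_eq (W := W) x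
      rcases hfib P hx with h1 | h1
      · refine ⟨⟨P - P₀, ?_⟩, ?_⟩
        · change α (P - P₀) = 0
          rw [map_sub, h1, hQ, sub_self]
        · simp
      · refine ⟨⟨-P - P₀, ?_⟩, ?_⟩
        · change α (-P - P₀) = 0
          rw [map_sub, map_neg, h1, hQ, neg_neg, sub_self]
        · simp [xCoord_neg]
  have e := Equiv.ofBijective _ hbij
  refine ⟨Finite.of_equiv _ e.symm, ?_⟩
  rw [Nat.card_congr e, Nat.card_eq_fintype_card, Fintype.card_coe, hcard, hdeg]

end Kernel

/-! ### Degree and slope of `φ - m` -/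

section DegreeSequence

variable {K : Type*} [Field K] [DecidableEq K] {W : WeierstrassCurve.Affine K}

/-- The degree of `φ - m` is a quadratic polynomial in `m` and its slope at infinity is `m ^ 2`, if `φ`
is given on `x`-coordinates by `x ↦ x ^ q` with `q ≥ 2`. -/
lemma exists_isXMap_sub_natCast [IsAlgClosed K] [W.IsElliptic] {φ : AddMonoid.End W.Point} {q : ℕ}
    (hq : 2 ≤ q) (hφ : IsEndomorphism φ) (hφq : IsXMap φ (X ^ q) 1) :
    ∃ s : ℤ, ∀ m : ℕ, ∃ A B : K[X], IsXMap (φ - (m : AddMonoid.End W.Point)) A B ∧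
      (ratDegree A B : ℤ) = m ^ 2 - s * m + q ∧ HasSlope A B (m ^ 2) := by
  have hex : ∀ m : ℤ, ∃ A B : K[X], IsXMap (φ - (m : AddMonoid.End W.Point)) A B ∧ (m = 0 → A = X ^ q ∧ B = 1) := by
    intro m
    rcases eq_or_ne m 0 with rfl | hm
    · exact ⟨X ^ q, 1, by simpa using hφq, fun _ => ⟨rfl, rfl⟩⟩
    · have hend : φ - (m : AddMonoid.End W.Point) ∈ endRing W :=
        Subring.sub_mem _ hφ (intCast_mem (endRing W) m)
      obtain ⟨A, B, h⟩ := IsEndomorphism.exists_isXMap hend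
      exact ⟨A, B, h, fun h0 => absurd h0 hm⟩
  choose A B hAB hAB0 using hex
  obtain ⟨hA0, hB0⟩ := hAB0 0 rfl
  have hstep : ∀ m : ℤ,
      IsAddSub W (A m) (B m) X 1 (A (m - 1)) (B (m - 1)) (A (m + 1)) (B (m + 1)) := by
    intro m
    refine (hAB m).isAddSub IsXMap.one ?_ ?_
    · convert hAB (m - 1) using 1
      push_cast
      abel
    · convert hAB (m + 1) using 1
      push_cast
      abel
  have hX : ratDegree (X : K[X]) 1 = 1 := by simp [ratDegree]
  have hdeg : ∀ m : ℤ, ratDegree (A (m - 1)) (B (m - 1)) + ratDegree (A (m + 1)) (B (m + 1)) =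
      2 * ratDegree (A m) (B m) + 2 := by
    intro m
    rw [(hstep m).ratDegree_add (hAB _).isCoprime isCoprime_one_right (hAB _).isCoprime
      (hAB _).isCoprime, hX]
    ring
  have hdeg0 : ratDegree (A 0) (B 0) = q := by
    rw [hA0, hB0]
    simp [ratDegree]
  -- Since `q ≥ 2`, the function `1 / X ^ q` vanishes to order at least two at infinity.
  have hslope0 : HasSlope (A 0) (B 0) 0 := by
    rw [HasSlope, hdeg0, hA0, hB0]
    have h1 : reflect q (X ^ q : K[X]) = 1 := by
      simp
    have h2 : reflect q (1 : K[X]) = X ^ q := by simp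
    rw [h1, h2]
    simp [coeff_X_pow, show (0 : ℕ) ≠ q by omega, show (1 : ℕ) ≠ q by omega]
  have hslope : ∀ m : ℤ, ∀ e, HasSlope (A m) (B m) e → ∃ f f' : K,
      HasSlope (A (m - 1)) (B (m - 1)) f ∧ HasSlope (A (m + 1)) (B (m + 1)) f' ∧
        f + f' = 2 * (1 + e) ∧ f * f' = (1 - e) ^ 2 := fun m e he =>
    (hstep m).hasSlope (hAB _).isCoprime (hAB _).isCoprime (hAB _).isCoprime he
  -- The sum relation is a second-order recurrence for the slopes, so two consecutive values are
  -- carried along.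
  have main : ∀ m : ℕ, HasSlope (A m) (B m) (m ^ 2) ∧
      HasSlope (A (m + 1 : ℤ)) (B (m + 1 : ℤ)) ((m + 1) ^ 2) := by
    intro m
    induction m with
    | zero =>
      obtain ⟨f, f', -, h2, h3, h4⟩ := hslope 0 0 hslope0
      have hf : f' = 1 := by
        -- At `m = 0` no earlier slope is known, but sum 2 and product 1 force both neighbours to
        -- have slope 1.
        have : (f' - 1) ^ 2 = 0 := by linear_combination f' * h3 - h4
        exact sub_eq_zero.mp (pow_eq_zero_iff (two_ne_zero) |>.mp this)
      subst hf
      simpa using ⟨hslope0, h2⟩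
    | succ m ih =>
      obtain ⟨f, f', h1, h2, h3, -⟩ := hslope _ _ ih.2
      rw [add_sub_cancel_right] at h1
      have hf := h1.unique ih.1
      have hf' : f' = ((m : K) + 1 + 1) ^ 2 := by linear_combination h3 - hf
      subst hf'
      push_cast
      exact ⟨ih.2, h2⟩
  -- The second difference of the degrees is 2 and the value at 0 is `q`, so the linear coefficient
  -- is fixed by the value at 1.
  refine ⟨q + 1 - ratDegree (A 1) (B 1), fun m => ⟨A m, B m, by simpa using hAB m, ?_, (main m).1⟩⟩
  have hmain : ∀ m : ℕ, (ratDegree (A m) (B m) : ℤ) =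
        m ^ 2 - (q + 1 - ratDegree (A 1) (B 1)) * m + q ∧
      (ratDegree (A (m + 1 : ℤ)) (B (m + 1 : ℤ)) : ℤ) =
        (m + 1) ^ 2 - (q + 1 - ratDegree (A 1) (B 1)) * (m + 1) + q := by
    intro m
    induction m with
    | zero =>
      simp only [Nat.cast_zero, hdeg0, zero_add]
      constructor <;> ring
    | succ m ih =>
      have h := hdeg (m + 1)
      rw [add_sub_cancel_right] at h
      zify at h
      push_cast
      refine ⟨ih.2, ?_⟩
      linear_combination h - ih.1 + 2 * ih.2
  exact (hmain m).1

end DegreeSequence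

/-! ### Counting the kernel of `π - m` -/

section FrobeniusCount

variable {F : Type*} [Field F] [Fintype F] (W : WeierstrassCurve.Affine F)
  (K : Type*) [Field K] [Algebra F K] [DecidableEq K]

lemma frob_some {x y : K} (h : (W⁄K).Nonsingular x y) :
    ∃ h', frob W K (.some x y h) = .some (x ^ Fintype.card F) (y ^ Fintype.card F) h' :=
  ⟨_, rfl⟩

lemma isXMap_frob : IsXMap (frob W K) (X ^ Fintype.card F) 1 where
  isCoprime := isCoprime_one_right
  eventually := by
    filter_upwards [eventually_ne_zero] with P hP
    rcases P with _ | ⟨x, y, h⟩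
    · exact absurd rfl hP
    · obtain ⟨h', hfrob⟩ := frob_some W K h
      refine ⟨1, ?_⟩
      rw [hfrob]
      simp [xCoord]

lemma mem_range_algebraMap_of_pow_card_eq {x : K} (hx : x ^ Fintype.card F = x) :
    ∃ y : F, algebraMap F K y = x := by
  classical
  have hinj := (algebraMap F K).injective
  have hne : (X ^ Fintype.card F - X : K[X]) ≠ 0 :=
    FiniteField.X_pow_card_sub_X_ne_zero K Fintype.one_lt_card
  by_contra! h
  have hsub : insert x (Finset.univ.image (algebraMap F K)) ⊆
      (X ^ Fintype.card F - X : K[X]).roots.toFinset := by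
    intro z hz
    rw [Multiset.mem_toFinset, mem_roots hne]
    rcases Finset.mem_insert.mp hz with rfl | hz
    · simp [hx]
    · obtain ⟨y, -, rfl⟩ := Finset.mem_image.mp hz
      simp [← map_pow, FiniteField.pow_card]
  have h1 := Finset.card_le_card hsub
  rw [Finset.card_insert_of_notMem (by simpa using h), Finset.card_image_of_injective _ hinj,
    Finset.card_univ] at h1
  have h2 := Multiset.toFinset_card_le (X ^ Fintype.card F - X : K[X]).roots
  have h3 := card_roots' (X ^ Fintype.card F - X : K[X])
  rw [FiniteField.X_pow_card_sub_X_natDegree_eq K Fintype.one_lt_card] at h3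
  omega

/-- The fixed points of `π` are the points with coordinates in `F`, the elements of `F` being
exactly the solutions of `x ^ q = x`. -/
lemma card_ker_frob_sub_one :
    Nat.card (AddMonoidHom.ker (frob W K - (1 : AddMonoid.End (W⁄K).Point))) = Nat.card W.Point := by
  symm
  have hns : ∀ x y : F, (W⁄K).Nonsingular (algebraMap F K x) (algebraMap F K y) ↔
      W.Nonsingular x y := WeierstrassCurve.Affine.map_nonsingular _ (algebraMap F K).injective
  let f : W.Point → (W⁄K).Point := fun P => match P with
    | .zero => .zero
    | .some x y h => .some (algebraMap F K x) (algebraMap F K y) ((hns x y).mpr h)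
  have hker : ∀ P : (W⁄K).Point, P ∈ AddMonoidHom.ker (frob W K - (1 : AddMonoid.End (W⁄K).Point)) ↔ frob W K P = P := by
    intro P
    exact sub_eq_zero
  have hf : ∀ P, f P ∈ AddMonoidHom.ker (frob W K - (1 : AddMonoid.End (W⁄K).Point)) := by
    intro P
    rw [hker]
    rcases P with _ | ⟨x, y, h⟩
    · rfl
    · simp only [f]
      obtain ⟨h', hfrob⟩ := frob_some W K ((hns x y).mpr h)
      rw [hfrob]
      simp [← map_pow, FiniteField.pow_card]
  refine Nat.card_congr (Equiv.ofBijective (fun P => (⟨f P, hf P⟩ :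
    AddMonoidHom.ker (frob W K - (1 : AddMonoid.End (W⁄K).Point)))) ⟨?_, ?_⟩)
  · intro P Q hPQ
    have h : f P = f Q := congrArg Subtype.val hPQ
    rcases P with _ | ⟨x, y, hP⟩ <;> rcases Q with _ | ⟨x', y', hQ⟩
    · rfl
    · cases h
    · cases h
    · simp only [f, WeierstrassCurve.Affine.Point.some.injEq, (algebraMap F K).injective.eq_iff] at h
      simp [h]
  · rintro ⟨P, hP⟩
    rw [hker] at hP
    rcases P with _ | ⟨x, y, h⟩
    · exact ⟨.zero, rfl⟩
    · obtain ⟨h', hfrob⟩ := frob_some W K h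
      rw [hfrob, WeierstrassCurve.Affine.Point.some.injEq] at hP
      obtain ⟨x, rfl⟩ := mem_range_algebraMap_of_pow_card_eq (F := F) K hP.1
      obtain ⟨y, rfl⟩ := mem_range_algebraMap_of_pow_card_eq (F := F) K hP.2
      exact ⟨.some x y ((hns x y).mp h), rfl⟩

/-- The number of points in the kernel of `π - m` is `χ_π(m)`, for integers `m` prime to the
characteristic. -/
lemma card_ker_frob_sub_natCast [IsAlgClosed K] [W.IsElliptic]
    (hπ : IsEndomorphism (frob W K)) {m : ℕ} (hm : (m : K) ≠ 0) :
    Finite (AddMonoidHom.ker (frob W K - (m : AddMonoid.End (W⁄K).Point))) ∧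
      (Nat.card (AddMonoidHom.ker (frob W K - (m : AddMonoid.End (W⁄K).Point))) : ℤ) =
        m ^ 2 - frobTrace W * m + Fintype.card F := by
  obtain ⟨s, hs⟩ := exists_isXMap_sub_natCast (Fintype.one_lt_card (α := F)) hπ (isXMap_frob W K)
  have key : ∀ m : ℕ, (m : K) ≠ 0 → Finite (AddMonoidHom.ker (frob W K - (m : AddMonoid.End (W⁄K).Point))) ∧
      (Nat.card (AddMonoidHom.ker (frob W K - (m : AddMonoid.End (W⁄K).Point))) : ℤ) = m ^ 2 - s * m + Fintype.card F := by
    intro m hm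
    obtain ⟨A, B, h1, h2, h3⟩ := hs m
    have hend : frob W K - (m : AddMonoid.End (W⁄K).Point) ∈ endRing (W⁄K) :=
      Subring.sub_mem _ hπ (natCast_mem (endRing (W⁄K)) m)
    obtain ⟨h4, h5⟩ := h1.card_ker hend (h3.wronskian_ne_zero (pow_ne_zero 2 hm))
    exact ⟨h4, by rw [h5, h2]⟩
  -- The case `m = 1` reads `#E(𝔽_q) = 1 - s + q`, which identifies `s` with the trace.
  have h1 := (key 1 (by simp)).2
  rw [Nat.cast_one, card_ker_frob_sub_one] at h1
  have hst : s = frobTrace W := by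
    rw [frobTrace]
    linear_combination h1
  exact hst ▸ key m hm

end FrobeniusCount

/-! ### Scalar action on a subgroup of prime order -/

lemma charpoly_eq_X_sub_C_of_apply_eq_smul {k V : Type*} [Field k] [AddCommGroup V] [Module k V]
    [FiniteDimensional k V] (hV : Module.finrank k V = 1) {f : V →ₗ[k] V} {c : k}
    (hf : ∀ v, f v = c • v) : f.charpoly = X - C c := by
  have h : f = (0 : Module.End k V) - (-c) • (1 : Module.End k V) := by
    ext v
    simp [hf]
  rw [h, LinearMap.charpoly_sub_smul, LinearMap.charpoly_zero, hV]
  simp [sub_eq_add_neg]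

section Torsion

variable {M : Type*} [AddCommGroup M]

lemma inducedCharpoly_eq_X_sub_C {f : AddMonoid.End M} {N : AddSubgroup M} {l : ℕ} [Fact l.Prime]
    [Module (ZMod l) N] [Finite N] {m : ℕ} (hstab : ∀ P ∈ N, f P ∈ N)
    (hf : ∀ P ∈ N, f P = m • P) (hcard : Nat.card N = l) :
    inducedCharpoly f N l hstab = X - C (m : ZMod l) := by
  have hl : l.Prime := Fact.out
  have hrank : Module.finrank (ZMod l) N = 1 := by
    have h := (FiniteField.pow_finrank_eq_natCard l N).symm
    rw [hcard] at h
    exact (Nat.pow_right_injective hl.two_le (by simpa using h)).symm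
  refine charpoly_eq_X_sub_C_of_apply_eq_smul hrank fun P => ?_
  rw [Nat.cast_smul_eq_nsmul]
  exact Subtype.ext (hf P P.2)

/-- If `f` acts as multiplication by `m` on a subgroup of prime order `ℓ`, then its characteristic
polynomial there is `X - m`. -/
lemma hasCharpolyOn_of_card_eq {f : AddMonoid.End M} {N : AddSubgroup M} {l : ℕ} [Fact l.Prime]
    {m : ℕ} (htors : ∀ P ∈ N, l • P = 0) (hf : ∀ P ∈ N, f P = m • P) (hcard : Nat.card N = l) :
    HasCharpolyOn f N l (X - C (m : ZMod l)) := by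
  have hl : l.Prime := Fact.out
  have hfin : Finite N := Nat.finite_of_card_ne_zero (hcard ▸ hl.ne_zero)
  have htors' : ∀ P : N, l • P = 0 := fun P => Subtype.ext (htors P P.2)
  let : Module (ZMod l) N := AddCommGroup.zmodModule htors'
  exact ⟨hfin, htors', fun P hP => hf P hP ▸ N.nsmul_mem hP m,
    inducedCharpoly_eq_X_sub_C _ hf hcard⟩

/-- A torsion group of exponent `ℓ` contained in a finite group of order `n` has order `ℓ` if it is
nontrivial and if there is such an `n` not divisible by `ℓ ^ 2`. -/
lemma card_eq_prime {N H : AddSubgroup M} {l : ℕ} [Fact l.Prime]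
    (htors : ∀ P ∈ N, l • P = 0) (hNH : N ≤ H) [Finite H] (h0 : N ≠ ⊥)
    (hH : ¬ l ^ 2 ∣ Nat.card H) : Nat.card N = l := by
  have hl : l.Prime := Fact.out
  have hfin : Finite N := Finite.of_injective _ (AddSubgroup.inclusion_injective hNH)
  have htors' : ∀ P : N, l • P = 0 := fun P => Subtype.ext (htors P P.2)
  let : Module (ZMod l) N := AddCommGroup.zmodModule htors'
  have h := (FiniteField.pow_finrank_eq_natCard l N).symm
  have hdvd := AddSubgroup.card_dvd_of_le hNH
  rw [h] at hdvd ⊢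
  generalize Module.finrank (ZMod l) N = d at *
  rcases d with _ | _ | d
  · rw [pow_zero, AddSubgroup.card_eq_one] at h
    exact absurd h h0
  · rw [zero_add, pow_one]
  · exact absurd ((pow_dvd_pow l (by omega)).trans hdvd) hH

end Torsion

/-! ### Ideals of prime index and their kernels -/

/-- If the left ideal `𝔞 ∋ U(π)` of `O` has prime index `ℓ`, then `U` has a root modulo `ℓ`. -/
lemma exists_dvd_eval_of_index_eq_prime {O : Type*} [Ring O] {a : Ideal O} {l : ℕ} [Fact l.Prime]
    (hindex : (Submodule.toAddSubgroup a).index = l) {π : O} {U : ℤ[X]} (hU : aeval π U ∈ a) :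
    ∃ c : ℤ, (l : ℤ) ∣ U.eval c := by
  have hl : l.Prime := Fact.out
  have hla : ∀ x : O, (l : O) * x ∈ a := by
    intro x
    have := (Submodule.toAddSubgroup a).nsmul_index_mem x
    rw [hindex, nsmul_eq_mul] at this
    exact this
  have h1a : (1 : O) ∉ a := by
    intro h1
    have htop : Submodule.toAddSubgroup a = ⊤ := by
      rw [(Ideal.eq_top_iff_one a).mpr h1]
      rfl
    rw [htop, AddSubgroup.index_top] at hindex
    exact hl.one_lt.ne hindex
  have hint : ∀ c : ℤ, (c : O) ∈ a → (l : ℤ) ∣ c := by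
    intro c hc
    by_contra hlc
    obtain ⟨x, y, hxy⟩ := ((Nat.prime_iff_prime_int.mp hl).coprime_iff_not_dvd.mpr hlc)
    apply h1a
    have h := congrArg (Int.cast : ℤ → O) hxy
    push_cast at h
    rw [← h]
    refine add_mem ?_ (Ideal.mul_mem_left _ _ hc)
    have := hla (x : O)
    rwa [(Nat.cast_commute l (x : O)).eq] at this
  have hcard : Nat.card (O ⧸ Submodule.toAddSubgroup a) = l := hindex
  -- The additive quotient has prime order and the class of 1 is nonzero, so that class generates
  -- it.
  obtain ⟨c, hc⟩ : ∃ c : ℤ, π - c ∈ a := by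
    have hfact : Fact (Nat.card (O ⧸ Submodule.toAddSubgroup a)).Prime := ⟨hcard ▸ hl⟩
    have h1 : ((1 : O) : O ⧸ Submodule.toAddSubgroup a) ≠ 0 := fun h =>
      h1a ((QuotientAddGroup.eq_zero_iff _).mp h)
    obtain ⟨c, hc⟩ := AddSubgroup.mem_zmultiples_iff.mp
      (mem_zmultiples_of_prime_card rfl h1 (g' := (π : O ⧸ Submodule.toAddSubgroup a)))
    refine ⟨c, ?_⟩
    have h2 : ((π - (c : O) : O) : O ⧸ Submodule.toAddSubgroup a) = 0 := by
      rw [QuotientAddGroup.mk_sub, ← hc, sub_eq_zero, ← zsmul_one c, QuotientAddGroup.mk_zsmul]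
    exact (QuotientAddGroup.eq_zero_iff _).mp h2
  refine ⟨c, hint _ ?_⟩
  obtain ⟨V, hV⟩ := X_sub_C_dvd_sub_C_eval (a := c) (p := U)
  have h := congrArg (aeval π) hV
  -- The factor `π - c` has to stand on the right because `a` is a left ideal.
  rw [mul_comm, map_mul, map_sub, map_sub, aeval_X, aeval_C, aeval_C] at h
  simp only [algebraMap_int_eq, eq_intCast] at h
  rw [← sub_sub_cancel (aeval π U) ((U.eval c : ℤ) : O), h]
  exact sub_mem hU (Ideal.mul_mem_left _ _ hc)

/-- An irreducible polynomial with a root is linear. -/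
lemma exists_eq_X_sub_C_natCast {l : ℕ} [Fact l.Prime] {U : ℤ[X]} {u : (ZMod l)[X]}
    (hU : U.map (Int.castRingHom (ZMod l)) = u) (hmonic : u.Monic) (hirr : Irreducible u)
    {c : ℤ} (hc : (l : ℤ) ∣ U.eval c) : u = X - C (c : ZMod l) := by
  have hroot : u.IsRoot (c : ZMod l) := by
    have h := eval_map_apply (f := Int.castRingHom (ZMod l)) (p := U) c
    rw [hU, eq_intCast, eq_intCast, (ZMod.intCast_zmod_eq_zero_iff_dvd _ l).mpr hc] at h
    exact h
  exact (eq_of_monic_of_associated (monic_X_sub_C _) hmonic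
    ((irreducible_X_sub_C _).associated_of_dvd hirr (dvd_iff_isRoot.mpr hroot))).symm

/-- The kernel of `(ℓ, U(π))` consists of the `ℓ`-torsion points on which `π` acts as `m`, if `U` is
congruent to `X - m` modulo `ℓ`. -/
lemma mem_idealKernel_span_pair {M : Type*} [AddCommGroup M] {O : Subring (AddMonoid.End M)}
    {l m : ℕ} {U : ℤ[X]} (hU : U.map (Int.castRingHom (ZMod l)) = X - C (m : ZMod l)) (π : O)
    {P : M} : P ∈ idealKernel (Ideal.span {(l : O), aeval π U}) ↔
      l • P = 0 ∧ (π : AddMonoid.End M) P = m • P := by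
  obtain ⟨V, hV⟩ : C (l : ℤ) ∣ U - (X - C (m : ℤ)) := by
    rw [C_dvd_iff_dvd_coeff]
    intro i
    rw [← ZMod.intCast_zmod_eq_zero_iff_dvd, ← eq_intCast (Int.castRingHom (ZMod l)), ← coeff_map,
      Polynomial.map_sub, hU]
    simp
  -- In this order the factor `ℓ` acts first and kills `P`.
  have hUeq : aeval π U = π - (m : O) + (aeval π V) * (l : O) := by
    have h : U = X - C (m : ℤ) + V * C (l : ℤ) := by linear_combination hV
    rw [h, map_add, map_sub, map_mul, aeval_X, aeval_C, aeval_C]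
    simp
  have hl : ∀ Q : M, ((l : O) : AddMonoid.End M) Q = l • Q := fun Q => by simp
  have hm : ∀ Q : M, ((m : O) : AddMonoid.End M) Q = m • Q := fun Q => by simp
  have happ : l • P = 0 → ((aeval π U : O) : AddMonoid.End M) P =
      (π : AddMonoid.End M) P - m • P := by
    intro h
    rw [hUeq, ← hm]
    change _ + ((aeval π V : O) : AddMonoid.End M) (((l : O) : AddMonoid.End M) P) = _
    rw [hl, h, map_zero, add_zero]
    rfl
  rw [mem_idealKernel]
  constructor
  · intro h
    have h1 : l • P = 0 := by
      rw [← hl]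
      exact h _ (Ideal.subset_span (by simp))
    refine ⟨h1, sub_eq_zero.mp ?_⟩
    rw [← happ h1]
    exact h _ (Ideal.subset_span (by simp))
  · rintro ⟨h1, h2⟩ α hα
    obtain ⟨β, γ, rfl⟩ := Ideal.mem_span_pair.mp hα
    change (β : AddMonoid.End M) (((l : O) : AddMonoid.End M) P) +
      (γ : AddMonoid.End M) (((aeval π U : O) : AddMonoid.End M) P) = 0
    rw [hl, h1, happ h1, h2, sub_self, map_zero, map_zero, add_zero]

/-! ### Lifts of a simple root modulo `ℓ` -/

/-- A root of `X² - tX + q` modulo a prime `ℓ` not dividing the discriminant lifts to two values of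
`X² - tX + q` that are not both divisible by `ℓ²`. -/
lemma not_sq_dvd_or_not_sq_dvd {l m k t q : ℤ} (hl : Prime l) (hk : ¬ l ∣ k)
    (hdisc : ¬ l ∣ t ^ 2 - 4 * q) :
    ¬ l ^ 2 ∣ m ^ 2 - t * m + q ∨ ¬ l ^ 2 ∣ (m + l * k) ^ 2 - t * (m + l * k) + q := by
  by_contra! h
  obtain ⟨⟨a, ha⟩, ⟨b, hb⟩⟩ := h
  -- The two values differ by `ℓk(2m - t) + ℓ²k²`; so if `ℓ²` divides both, `ℓ` divides `2m - t`,
  -- and with it `t² - 4q = (2m - t)² - 4(m² - tm + q)`.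
  have h1 : l ∣ k * (2 * m - t) := by
    refine ⟨b - a - k ^ 2, mul_left_cancel₀ hl.ne_zero ?_⟩
    linear_combination hb - ha
  obtain ⟨d, hd⟩ := (hl.dvd_or_dvd h1).resolve_left hk
  apply hdisc
  refine ⟨l * d ^ 2 - 4 * l * a, ?_⟩
  linear_combination (2 * m - t + l * d) * hd - 4 * ha

section Residues

variable {K : Type*} [Field K]

/-- A nonzero residue class modulo `ℓ` contains natural numbers `m` and `m + ℓ k` that are nonzero in
the field `K` of positive characteristic, with `k` prime to `ℓ`. -/
lemma exists_natCast_ne_zero {l : ℕ} [Fact l.Prime] {c : ZMod l} (hc : c ≠ 0) (p : ℕ) [CharP K p]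
    [Fact p.Prime] : ∃ m k : ℕ, (m : ZMod l) = c ∧ ¬ l ∣ k ∧ (m : K) ≠ 0 ∧
      ((m + l * k : ℕ) : K) ≠ 0 := by
  have hl : l.Prime := Fact.out
  have hp : p.Prime := Fact.out
  simp only [ne_eq, CharP.cast_eq_zero_iff K p]
  rcases eq_or_ne l p with rfl | hlp
  -- When `ℓ` is the characteristic, every lift of `c ≠ 0` is a unit in `K`, and `k = 1` serves.
  · have hm : ¬ l ∣ c.val := by
      rw [← ZMod.natCast_eq_zero_iff, ZMod.natCast_zmod_val]
      exact hc
    refine ⟨c.val, 1, ZMod.natCast_zmod_val c, ?_, hm, ?_⟩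
    · rw [Nat.dvd_one]
      exact hl.one_lt.ne'
    · rwa [← Nat.dvd_add_iff_left (Dvd.intro _ rfl)]
  · have hco : l.Coprime p := (Nat.coprime_primes hl hp).mpr hlp
    -- Otherwise `m` is chosen congruent to 1 modulo `p`; the step `k = p` preserves this and is
    -- prime to `ℓ`.
    obtain ⟨m, hm1, hm2⟩ := Nat.chineseRemainder hco c.val 1
    have hpm : ¬ p ∣ m := by
      rw [hm2.dvd_iff dvd_rfl, Nat.dvd_one]
      exact hp.one_lt.ne'
    refine ⟨m, p, ?_, ?_, hpm, ?_⟩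
    · rw [(ZMod.natCast_eq_natCast_iff _ _ _).mpr hm1, ZMod.natCast_zmod_val]
    · rw [Nat.prime_dvd_prime_iff_eq hl hp]
      exact hlp
    · rwa [← Nat.dvd_add_iff_left (Dvd.intro_left _ rfl)]

end Residues

end EllipticFrobenius

/-! ### The characteristic polynomial on the kernel of `𝔞` -/

theorem mainTheorem8
    {F : Type*} [Field F] [Fintype F]
    {K : Type*} [Field K] [DecidableEq K] [Algebra F K] [IsAlgClosed K] [Algebra.IsAlgebraic F K]
    (W : WeierstrassCurve.Affine F) [W.IsElliptic] (hW : EllipticFrobenius.IsOrdinary W K)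
    (O : Subring (AddMonoid.End (W⁄K).Point)) (hO : O ≤ EllipticFrobenius.endRing (W⁄K))
    (hπ : EllipticFrobenius.frob W K ∈ O)
    (l : ℕ) [Fact l.Prime] (hl : ¬ (l : ℤ) ∣ EllipticFrobenius.frobTrace W ^ 2 - 4 * Fintype.card F)
    (U : ℤ[X]) (u : (ZMod l)[X]) (hU : U.map (Int.castRingHom (ZMod l)) = u)
    (hmonic : u.Monic) (hirr : Irreducible u)
    (hdvd : u ∣ (EllipticFrobenius.frobPoly W).map (Int.castRingHom (ZMod l))) (huX : u ≠ X)
    (a : Ideal O) (ha : a = Ideal.span {(l : O), aeval (⟨EllipticFrobenius.frob W K, hπ⟩ : O) U})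
    (hnorm : (Submodule.toAddSubgroup a).index = l) :
    EllipticFrobenius.HasCharpolyOn (EllipticFrobenius.frob W K) (EllipticFrobenius.idealKernel a) l u := by
  open EllipticFrobenius in
  have hlp : l.Prime := Fact.out
  have hlZ : Prime (l : ℤ) := Nat.prime_iff_prime_int.mp hlp
  have hmem : aeval (⟨frob W K, hπ⟩ : O) U ∈ a := ha ▸ Ideal.subset_span (by simp)
  obtain ⟨c, hc⟩ := exists_dvd_eval_of_index_eq_prime hnorm hmem
  have huc := exists_eq_X_sub_C_natCast hU hmonic hirr hc
  have hc0 : (c : ZMod l) ≠ 0 := fun h => huX (by rw [huc, h, C_0, sub_zero])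
  obtain ⟨p, hchar⟩ := CharP.exists F
  have hp : Fact p.Prime := ⟨CharP.char_is_prime F p⟩
  have hcharK : CharP K p := charP_of_injective_algebraMap (algebraMap F K).injective p
  obtain ⟨m, k, hm, hk, hm0, hmk0⟩ := exists_natCast_ne_zero (K := K) hc0 p
  rw [← hm] at huc
  have hmemN : ∀ P, P ∈ idealKernel a ↔ l • P = 0 ∧ frob W K P = m • P := fun P => by
    rw [ha]
    exact mem_idealKernel_span_pair (hU.trans huc) _
  have hker : ∀ {n : ℕ} {P : (W⁄K).Point},
      P ∈ AddMonoidHom.ker (frob W K - (n : AddMonoid.End (W⁄K).Point)) ↔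
        frob W K P = n • P := fun {n P} =>
    sub_eq_zero.trans (Iff.of_eq (congrArg (frob W K P = ·) (AddMonoid.End.natCast_apply n P)))
  have hend : IsEndomorphism (frob W K) := hO hπ
  obtain ⟨hfin₁, hcard₁⟩ := card_ker_frob_sub_natCast W K hend hm0
  obtain ⟨hfin₂, hcard₂⟩ := card_ker_frob_sub_natCast W K hend hmk0
  have hdvd₁ : l ∣ Nat.card (AddMonoidHom.ker (frob W K - (m : AddMonoid.End (W⁄K).Point))) := by
    rw [← Int.natCast_dvd_natCast, hcard₁, ← ZMod.intCast_zmod_eq_zero_iff_dvd]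
    rw [huc, dvd_iff_isRoot] at hdvd
    simpa [frobPoly] using hdvd
  have hne : idealKernel a ≠ ⊥ := by
    -- A point of order `ℓ` in `ker(π - m)`, given by Cauchy's theorem, lies in the kernel of `𝔞`.
    obtain ⟨P, hP⟩ := exists_prime_addOrderOf_dvd_card' l hdvd₁
    intro hbot
    have hPN : (P : (W⁄K).Point) ∈ idealKernel a := by
      refine (hmemN _).mpr ⟨?_, hker.mp P.2⟩
      have := addOrderOf_nsmul_eq_zero P
      rw [hP] at this
      exact congrArg Subtype.val this
    rw [hbot, AddSubgroup.mem_bot] at hPN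
    have hP0 : P = 0 := Subtype.ext hPN
    rw [hP0, addOrderOf_zero] at hP
    exact hlp.one_lt.ne hP
  have htors : ∀ P ∈ idealKernel a, l • P = 0 := fun P hP => ((hmemN P).mp hP).1
  have hact : ∀ P ∈ idealKernel a, frob W K P = m • P := fun P hP => ((hmemN P).mp hP).2
  rw [huc]
  refine hasCharpolyOn_of_card_eq htors hact ?_
  rcases not_sq_dvd_or_not_sq_dvd (m := m) (k := k) hlZ (by exact_mod_cast hk) hl with h | h
  · refine card_eq_prime htors (fun P hP => hker.mpr (hact P hP)) hne ?_
    rw [← hcard₁] at h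
    exact_mod_cast h
  · refine card_eq_prime htors (fun P hP => hker.mpr ?_) hne (H := AddMonoidHom.ker
      (frob W K - ((m + l * k : ℕ) : AddMonoid.End (W⁄K).Point))) ?_
    -- Since `ℓ` kills the kernel of `𝔞`, the scalars `m` and `m + ℓk` act on it alike.
    · rw [hact P hP, add_nsmul, mul_comm, mul_nsmul', htors P hP, nsmul_zero, add_zero]
    · push_cast at hcard₂
      rw [← hcard₂] at h
      exact_mod_cast h
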